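/- Let $\tau$ be a complex number with $\operatorname{Im}\tau>0$, put $q=e^{2\pi i\tau}$ and $q^{r}=e^{2\pi i\tau r}$ for real $r$, and let $\eta(\tau)=q^{1/24}\prod_{n\ge1}(1-q^n)$. Write $$j(x;q)=\sum_{n\in\mathbb Z}(-1)^nq^{n(n-1)/2}x^n,\qquad J_{a,m}=j(q^a;q^m),$$ $$f_{a,b,c}(x,y,q)=\Big(\sum_{r,s\ge0}-\sum_{r,s<0}\Big)(-1)^{r+s}x^ry^sq^{a\frac{r(r-1)}2+brs+c\frac{s(s-1)}2}.$$ For integers $m,\ell,N$ with $0\le\ell\le N$, $N\ge1$ and $m\equiv\ell\pmod 2$, let $c_{N-m,m}^{N-\ell,\ell}$ denote the level-$N$ string function of the affine Lie algebra $A_1^{(1)}$, given by the Kac–Peterson series $$c_{N-m,m}^{N-\ell,\ell}(\tau)=\frac1{\eta(\tau)^3}\sum_{(x,y)}\operatorname{sg}(x)\,q^{(N+2)x^2-Ny^2},$$ where $\operatorname{sg}(x)=1$ for $x\ge0$ and $-1$ for $x<0$, and the sum is over all $(x,y)\in\mathbb R^2$ with $-|x|<y\le|x|$ such that $(x,y)$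 or $(\tfrac12-x,\tfrac12+y)$ lies in $\big(\tfrac{\ell+1}{2(N+2)},\tfrac m{2N}\big)+\mathbb Z^2$. Then: 1. The double series $f_{6,6,1}(q^6,q^4,q)$ converges absolutely, and $$f_{6,6,1}(q^6,q^4,q)=J_{4,10}\,J_{3,15}.$$ 2. For $N=10$, $\ell=5$, $m=1$ the Kac–Peterson series converges absolutely, and $$c_{91}^{55}(\tau)=\eta(\tau)^{-3}q^{29/40}f_{6,6,1}(q^6,q^4,q),$$ so that the identity in 1 is equivalent to the evaluation in 3. 3. The level-10 string function has the Kac–Peterson evaluation $$c_{91}^{55}(\tau)=\eta(\tau)^{-3}q^{29/40}\prod_{\substack{n\ge1\\ n\not\equiv\pm1\ (\mathrm{mod}\ 5)}}(1-q^{2n})\prod_{\substack{n\ge1\\ n\not\equiv\pm2\ (\mathrm{mod}\ 5)}}(1-q^{3n}).$$ -/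

import Mathlib

noncomputable section

namespace HeckeString

/-- The power `q ^ r = exp (2 π i τ r)` of the nome `q = exp (2 π i τ)`, for a real exponent `r`. -/
def qPow (τ : UpperHalfPlane) (r : ℝ) : ℂ :=
  Complex.exp (2 * Real.pi * Complex.I * (τ : ℂ) * (r : ℂ))

/-- The theta function `j(x; q) = ∑_{n ∈ ℤ} (-1)^n q^{n(n-1)/2} x^n`. -/
def theta (x q : ℂ) : ℂ :=
  ∑' n : ℤ, (-1 : ℂ) ^ n * q ^ (n * (n - 1) / 2) * x ^ n

/-- `J_{a,m} = j(q^a; q^m)`. -/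
def thetaJ (a : ℤ) (m : ℕ) (q : ℂ) : ℂ :=
  theta (q ^ a) (q ^ m)

/-- The summand `(-1)^{r+s} x^r y^s q^{a r(r-1)/2 + b r s + c s(s-1)/2}`. -/
def heckeTerm (a b c : ℤ) (x y q : ℂ) (p : ℤ × ℤ) : ℂ :=
  (-1 : ℂ) ^ (p.1 + p.2) * x ^ p.1 * y ^ p.2 *
    q ^ (a * (p.1 * (p.1 - 1) / 2) + b * p.1 * p.2 + c * (p.2 * (p.2 - 1) / 2))

/-- The index pairs `(r, s)` with `r, s ≥ 0`. -/
def nonnegPairs : Set (ℤ × ℤ) := {p | 0 ≤ p.1 ∧ 0 ≤ p.2}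

/-- The index pairs `(r, s)` with `r, s < 0`. -/
def negPairs : Set (ℤ × ℤ) := {p | p.1 < 0 ∧ p.2 < 0}

/-- The Hecke-type double-sum `f_{a,b,c}(x, y, q)`. -/
def heckeSum (a b c : ℤ) (x y q : ℂ) : ℂ :=
  (∑' p : nonnegPairs, heckeTerm a b c x y q p) - ∑' p : negPairs, heckeTerm a b c x y q p

/-- Absolute convergence of the double series that defines `f_{a,b,c}(x, y, q)`. -/
def HeckeSummable (a b c : ℤ) (x y q : ℂ) : Prop :=
  (Summable fun p : nonnegPairs => heckeTerm a b c x y q p) ∧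
    Summable fun p : negPairs => heckeTerm a b c x y q p

/-- `(u, v) ∈ ((ℓ + 1) / (2 (N + 2)), m / (2 N)) + ℤ²`. -/
def InCoset (m l N : ℤ) (u v : ℝ) : Prop :=
  ∃ i k : ℤ, u = ((l : ℝ) + 1) / (2 * ((N : ℝ) + 2)) + i ∧ v = (m : ℝ) / (2 * (N : ℝ)) + k

/-- The index set of the Kac-Peterson double series: the `(x, y)` with `-|x| < y ≤ |x|` such that
`(x, y)` or `(1/2 - x, 1/2 + y)` lies in the coset above. -/
def kpIndex (m l N : ℤ) : Set (ℝ × ℝ) :=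
  {p | (-|p.1| < p.2 ∧ p.2 ≤ |p.1|) ∧
    (InCoset m l N p.1 p.2 ∨ InCoset m l N (1 / 2 - p.1) (1 / 2 + p.2))}

/-- The summand `sg(x) q^{(N + 2) x² - N y²}`, with `sg(x) = 1` for `x ≥ 0` and `-1` for `x < 0`. -/
def kpTerm (N : ℤ) (τ : UpperHalfPlane) (p : ℝ × ℝ) : ℂ :=
  (if 0 ≤ p.1 then 1 else -1) *
    qPow τ (((N : ℝ) + 2) * p.1 ^ 2 - (N : ℝ) * p.2 ^ 2)

/-- The level `N` string function `c_{N-m,m}^{N-ℓ,ℓ}(τ)` of type `A₁⁽¹⁾` in its Kac-Peterson form: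
`η(τ)⁻³` times an indefinite theta series. -/
def stringFunction (m l N : ℤ) (τ : UpperHalfPlane) : ℂ :=
  ModularForm.eta (τ : ℂ) ^ (-3 : ℤ) * ∑' p : kpIndex m l N, kpTerm N τ p

end HeckeString

end

open Filter Topology Finset

namespace HeckeString

/-! Put `Q = q^6` and write `(x; q)` for the infinite product `∏ (1 - x q^n)`. For fixed `s` the sum
over `r` in the double series is half of a theta series at `Q^(s+1)`. The full theta series vanishes
there, so its negative half is minus its nonnegative half. The two quadrants therefore merge into
one sum over all integers `s`, weighted by `recipCoeff Q s` (`heckeSum_eq_tsum_recipCoeff`).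

These weights are the Laurent coefficients of `(Q; Q)^3 / θ(w; Q)` on `|Q| < |w| < 1`
(`theta_mul_recipSeries`, `recipConst_eq`). Hence the double sum is the constant term in `z` of
`θ(z; q) (Q; Q)^3 / θ(q^4/z; Q)`. By the Jacobi triple product, `θ(q^4/z; Q)` divides `θ(z; q)`
(`theta_factor`). What remains is a product of three theta functions, whose constant term is a
positive definite binary theta series (`qPoch_mul_heckeSum`).

That series diagonalizes into two products of theta functions (`binaryTheta_eq`). After
multiplication by `(q^2; q^10)(q^8; q^10)` these become the two products into which a lattice
dissection splits `θ(-q^3; q^4) θ(q^3; q^15)` (`theta_mul_theta_split`, `binaryTheta_mul`).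
Elementary product identities then turn the remaining factors into `θ(q^4; q^10)`.

For the string function, `kpEquiv` matches the Kac–Peterson index set with the two quadrants. Signs
agree term by term, and exponents differ by the constant `29/40`. -/

/-- The infinite product `(x; q)_∞ = ∏_{n ≥ 0} (1 - x q ^ n)`. -/
noncomputable def qPoch (x q : ℂ) : ℂ := ∏' n : ℕ, (1 - x * q ^ n)

/-! ### Infinite q-products and their dissection -/

section qPoch

variable {q : ℂ}

lemma summable_norm_mul_pow (x : ℂ) (hq : ‖q‖ < 1) : Summable fun n : ℕ => ‖-(x * q ^ n)‖ := by
  simpa using (summable_geometric_of_lt_one (norm_nonneg _) hq).mul_left ‖x‖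

lemma multipliable_qPoch (x : ℂ) (hq : ‖q‖ < 1) : Multipliable fun n : ℕ => 1 - x * q ^ n := by
  simpa [sub_eq_add_neg] using multipliable_one_add_of_summable (summable_norm_mul_pow x hq)

lemma tendsto_qPoch (x : ℂ) (hq : ‖q‖ < 1) :
    Tendsto (fun n => ∏ k ∈ range n, (1 - x * q ^ k)) atTop (𝓝 (qPoch x q)) :=
  (multipliable_qPoch x hq).hasProd.tendsto_prod_nat

lemma qPoch_ne_zero {x : ℂ} (hx : ‖x‖ < 1) (hq : ‖q‖ < 1) : qPoch x q ≠ 0 := by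
  have := tprod_one_add_ne_zero_of_summable (f := fun n : ℕ => -(x * q ^ n)) (fun n h => ?_)
    (summable_norm_mul_pow x hq)
  · simpa [qPoch, sub_eq_add_neg] using this
  · have h1 : x * q ^ n = 1 := by linear_combination -h
    have h2 : ‖x * q ^ n‖ < 1 := by
      rw [norm_mul, norm_pow]
      exact mul_lt_one_of_nonneg_of_lt_one_left (norm_nonneg _) hx
        (pow_le_one₀ (norm_nonneg _) hq.le)
    simp [h1] at h2

lemma prod_range_mul_split {M : Type*} [CommMonoid M] (f : ℕ → M) (m n : ℕ) :
    ∏ i ∈ range (m * n), f i = ∏ k ∈ range m, ∏ i ∈ range n, f (m * i + k) := by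
  induction n with
  | zero => simp
  | succ n ih =>
    rw [Nat.mul_succ, prod_range_add, ih, ← prod_mul_distrib]
    exact prod_congr rfl fun k _ => (prod_range_succ (fun i => f (m * i + k)) n).symm

/-- Both sides are limits of the same finite products, taken along the multiples of `m`; no infinite
product is rearranged. -/
lemma qPoch_split (x : ℂ) (hq : ‖q‖ < 1) {m : ℕ} (hm : m ≠ 0) :
    qPoch x q = ∏ k ∈ range m, qPoch (x * q ^ k) (q ^ m) := by
  have hqm : ‖q ^ m‖ < 1 := by
    rw [norm_pow]; exact pow_lt_one₀ (norm_nonneg _) hq hm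
  have h1 : Tendsto (fun n => ∏ k ∈ range (m * n), (1 - x * q ^ k)) atTop (𝓝 (qPoch x q)) :=
    (tendsto_qPoch x hq).comp (tendsto_id.const_mul_atTop' (Nat.pos_of_ne_zero hm))
  refine tendsto_nhds_unique h1 ?_
  simp_rw [prod_range_mul_split]
  refine tendsto_finsetProd _ fun k _ => ?_
  refine (tendsto_qPoch (x * q ^ k) hqm).congr fun n => prod_congr rfl fun i _ => ?_
  ring

lemma qPoch_mul_neg (x : ℂ) (hq : ‖q‖ < 1) :
    qPoch x q * qPoch (-x) q = qPoch (x ^ 2) (q ^ 2) := by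
  rw [qPoch, qPoch, qPoch, ← (multipliable_qPoch x hq).tprod_mul (multipliable_qPoch (-x) hq)]
  refine tprod_congr fun n => ?_
  ring

lemma qPoch_eq_mul (x : ℂ) (hq : ‖q‖ < 1) : qPoch x q = (1 - x) * qPoch (x * q) q := by
  rw [qPoch, tprod_eq_zero_mul', qPoch]
  · simp [pow_succ', mul_assoc]
  · simpa [pow_succ', mul_assoc] using multipliable_qPoch (x * q) hq

end qPoch

/-! ### Triangular exponents and convergence of theta series -/

lemma two_mul_triangle (n : ℤ) : 2 * (n * (n - 1) / 2) = n * (n - 1) :=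
  Int.mul_ediv_cancel' (Int.even_mul_pred_self n).two_dvd

lemma triangle_succ (n : ℤ) : (n + 1) * (n + 1 - 1) / 2 = n * (n - 1) / 2 + n := by
  have h1 := two_mul_triangle n
  have h2 := two_mul_triangle (n + 1)
  linarith

lemma triangle_neg (n : ℤ) : -n * (-n - 1) / 2 = n * (n - 1) / 2 + n := by
  have h1 := two_mul_triangle n
  have h2 := two_mul_triangle (-n)
  linarith

/-- The summand of the theta function. -/
noncomputable def thetaTerm (x q : ℂ) (n : ℤ) : ℂ :=
  (-1 : ℂ) ^ n * q ^ (n * (n - 1) / 2) * x ^ n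

lemma thetaTerm_succ {x q : ℂ} (hx : x ≠ 0) (hq : q ≠ 0) (n : ℤ) :
    thetaTerm x q (n + 1) = -x * q ^ n * thetaTerm x q n := by
  simp only [thetaTerm]
  rw [triangle_succ, zpow_add₀ hq, zpow_add₀ hx, zpow_add₀ (by norm_num : (-1 : ℂ) ≠ 0)]
  simp only [zpow_one]
  ring

lemma thetaTerm_neg {x q : ℂ} (hq : q ≠ 0) (n : ℤ) :
    thetaTerm x q (-n) = thetaTerm (q / x) q n := by
  simp only [thetaTerm]
  rw [triangle_neg, zpow_add₀ hq, div_zpow, zpow_neg, zpow_neg,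
    ← inv_zpow (-1 : ℂ), show (-1 : ℂ)⁻¹ = -1 by norm_num]
  ring

lemma thetaTerm_ne_zero {x q : ℂ} (hx : x ≠ 0) (hq : q ≠ 0) (n : ℤ) : thetaTerm x q n ≠ 0 := by
  exact mul_ne_zero (mul_ne_zero (zpow_ne_zero _ (by norm_num)) (zpow_ne_zero _ hq))
    (zpow_ne_zero _ hx)

lemma summable_norm_thetaTerm_nat {x q : ℂ} (hx : x ≠ 0) (hq0 : q ≠ 0) (hq : ‖q‖ < 1) :
    Summable fun n : ℕ => ‖thetaTerm x q n‖ := by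
  refine summable_of_ratio_test_tendsto_lt_one (l := 0) (by norm_num)
    (Eventually.of_forall fun n => by simpa using thetaTerm_ne_zero hx hq0 n) ?_
  have h : Tendsto (fun n : ℕ => ‖x‖ * ‖q‖ ^ n) atTop (𝓝 (‖x‖ * 0)) :=
    (tendsto_pow_atTop_nhds_zero_of_lt_one (norm_nonneg _) hq).const_mul _
  rw [mul_zero] at h
  refine h.congr fun n => ?_
  have h0 : ‖thetaTerm x q n‖ ≠ 0 := by simpa using thetaTerm_ne_zero hx hq0 n
  push_cast
  rw [thetaTerm_succ hx hq0]
  simp only [norm_mul, norm_neg, norm_norm, zpow_natCast, norm_pow]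
  field_simp

lemma summable_norm_thetaTerm {x q : ℂ} (hx : x ≠ 0) (hq0 : q ≠ 0) (hq : ‖q‖ < 1) :
    Summable fun n : ℤ => ‖thetaTerm x q n‖ := by
  refine Summable.of_nat_of_neg (summable_norm_thetaTerm_nat hx hq0 hq) ?_
  simp_rw [thetaTerm_neg hq0]
  exact summable_norm_thetaTerm_nat (div_ne_zero hq0 hx) hq0 hq

lemma theta_eq_tsum (x q : ℂ) : theta x q = ∑' n, thetaTerm x q n := rfl

lemma hasSum_theta {x q : ℂ} (hx : x ≠ 0) (hq0 : q ≠ 0) (hq : ‖q‖ < 1) :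
    HasSum (thetaTerm x q) (theta x q) :=
  (summable_norm_thetaTerm hx hq0 hq).of_norm.hasSum

/-! ### The Jacobi triple product -/

section TripleProduct

/-- The reciprocal of `(q; q)_m`, extended by zero to negative `m`. -/
noncomputable def invPoch (q : ℂ) (m : ℤ) : ℂ :=
  if m < 0 then 0 else (∏ k ∈ range m.toNat, (1 - q * q ^ k))⁻¹

variable {q : ℂ}

lemma one_sub_ne_zero (hq : ‖q‖ < 1) (k : ℕ) : 1 - q * q ^ k ≠ 0 := by
  intro h
  have h1 : q ^ (k + 1) = 1 := by rw [pow_succ']; linear_combination -h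
  have h2 : ‖q ^ (k + 1)‖ < 1 := by
    rw [norm_pow]; exact pow_lt_one₀ (norm_nonneg _) hq k.succ_ne_zero
  simp [h1] at h2

/-- Extension by zero makes the recurrence valid for every integer: at `m = 0` the factor `1 - q^0`
vanishes. The induction below thus needs no boundary cases. -/
lemma invPoch_pred (hq : ‖q‖ < 1) (m : ℤ) :
    invPoch q (m - 1) = (1 - q ^ m) * invPoch q m := by
  rcases lt_trichotomy m 0 with h | rfl | h
  · simp [invPoch, h, show m < 1 by omega]
  · simp [invPoch]
  · obtain ⟨k, rfl⟩ : ∃ k : ℕ, m = k + 1 := ⟨(m - 1).toNat, by omega⟩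
    have e1 : ((k : ℤ) + 1 - 1).toNat = k := by omega
    have e2 : ((k : ℤ) + 1).toNat = k + 1 := by omega
    rw [invPoch, invPoch, if_neg (by omega), if_neg (by omega), e1, e2, prod_range_succ]
    have h1 := one_sub_ne_zero hq k
    have h2 : ∏ k ∈ range k, (1 - q * q ^ k) ≠ 0 :=
      prod_ne_zero_iff.2 fun i _ => one_sub_ne_zero hq i
    have h3 : q ^ ((k : ℤ) + 1) = q * q ^ k := by
      rw [← Nat.cast_succ, zpow_natCast, pow_succ']
    rw [h3]
    field_simp

/-- Cauchy's finite form of the triple product, with the Gaussian binomials `(q)_{2n} / ((q)_{n-j}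
(q)_{n+j})` as coefficients. Passing from `n` to `n + 1` multiplies by `(1 - x q^n)(1 - q^(n+1)/x) =
1 + q^(2n+1) - x q^n - q^(n+1)/x`, that is, combines the series with its two shifts in `j`. -/
lemma hasSum_finite_tripleProduct {x : ℂ} (hx : x ≠ 0) (hq0 : q ≠ 0) (hq : ‖q‖ < 1) (n : ℕ) :
    HasSum (fun j : ℤ => (∏ k ∈ range (2 * n), (1 - q * q ^ k)) *
        (invPoch q (n - j) * invPoch q (n + j)) * thetaTerm x q j)
      ((∏ k ∈ range n, (1 - x * q ^ k)) * ∏ k ∈ range n, (1 - q / x * q ^ k)) := by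
  induction n with
  | zero =>
    convert hasSum_single (0 : ℤ) fun j hj => ?_ using 1
    · simp [invPoch, thetaTerm]
    · rcases lt_or_gt_of_ne hj with h | h
      · simp [invPoch, h]
      · simp [invPoch, h]
  | succ n ih =>
    have s1 := (Equiv.subRight (1 : ℤ)).hasSum_iff.2 ih
    have s2 := (Equiv.addRight (1 : ℤ)).hasSum_iff.2 ih
    have s := ((ih.mul_left (1 + q ^ (2 * n + 1))).sub (s1.mul_left (x * q ^ n))).sub
      (s2.mul_left (q / x * q ^ n))
    refine Eq.mpr (congrArg₂ (fun f a => HasSum f a) (funext fun j => ?_) ?_) s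
    · simp only [Function.comp_apply, Equiv.subRight_apply, Equiv.coe_addRight]
      have t1 : thetaTerm x q (j + 1) = -x * q ^ j * thetaTerm x q j := thetaTerm_succ hx hq0 j
      have t2 : x * q ^ n * thetaTerm x q (j - 1) = -q * q ^ ((n : ℤ) - j) * thetaTerm x q j := by
        have := thetaTerm_succ hx hq0 (j - 1)
        rw [sub_add_cancel] at this
        rw [this, zpow_sub₀ hq0, zpow_sub₀ hq0]
        simp only [zpow_natCast, zpow_one]
        field_simp
      have a1 := invPoch_pred hq ((n : ℤ) - j)
      have a2 := invPoch_pred hq ((n : ℤ) - j + 1)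
      have b1 := invPoch_pred hq ((n : ℤ) + j)
      have b2 := invPoch_pred hq ((n : ℤ) + j + 1)
      rw [add_sub_cancel_right] at a2 b2
      have e1 : ((n + 1 : ℕ) : ℤ) - j = (n : ℤ) - j + 1 := by push_cast; ring
      have e2 : ((n + 1 : ℕ) : ℤ) + j = (n : ℤ) + j + 1 := by push_cast; ring
      have e3 : (n : ℤ) - (j - 1) = (n : ℤ) - j + 1 := by ring
      have e4 : (n : ℤ) + (j - 1) = (n : ℤ) + j - 1 := by ring
      have e5 : (n : ℤ) - (j + 1) = (n : ℤ) - j - 1 := by ring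
      have e6 : (n : ℤ) + (j + 1) = (n : ℤ) + j + 1 := by ring
      rw [e1, e2, e3, e4, e5, e6, a1, b1, a2, b2, t1, Nat.mul_succ, prod_range_succ,
        prod_range_succ]
      have p1 : q ^ ((n : ℤ) - j + 1) = q * q ^ ((n : ℤ) - j) := by
        rw [zpow_add₀ hq0, zpow_one, mul_comm]
      have p2 : q ^ ((n : ℤ) + j + 1) = q * q ^ ((n : ℤ) + j) := by
        rw [zpow_add₀ hq0, zpow_one, mul_comm]
      have p3 : q ^ (2 * n) = q ^ ((n : ℤ) - j) * q ^ ((n : ℤ) + j) := by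
        rw [← zpow_add₀ hq0, ← zpow_natCast]; congr 1; push_cast; ring
      have p4 : q ^ n * q ^ j = q ^ ((n : ℤ) + j) := by
        rw [zpow_add₀ hq0, zpow_natCast]
      rw [pow_succ q (2 * n), p1, p2, p3]
      generalize invPoch q ((n : ℤ) - j + 1) = A
      generalize invPoch q ((n : ℤ) + j + 1) = B
      generalize (∏ k ∈ range (2 * n), (1 - q * q ^ k)) = P
      have p5 : q / x * q ^ n * (P * (((1 - q ^ ((n : ℤ) - j)) * ((1 - q * q ^ ((n : ℤ) - j)) * A)) *
          B) * (-x * q ^ j * thetaTerm x q j)) = - q * q ^ ((n : ℤ) + j) *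
          (P * (((1 - q ^ ((n : ℤ) - j)) * ((1 - q * q ^ ((n : ℤ) - j)) * A)) *
          B) * thetaTerm x q j) := by
        rw [← p4]; field_simp
      rw [p5]
      linear_combination (P * (A * ((1 - q ^ ((n : ℤ) + j)) * ((1 - q * q ^ ((n : ℤ) + j)) * B)))) * t2
    · rw [prod_range_succ, prod_range_succ, pow_succ q, mul_comm 2 n, pow_mul]
      field_simp
      ring

lemma tendsto_invPoch (hq : ‖q‖ < 1) : Tendsto (invPoch q) atTop (𝓝 (qPoch q q)⁻¹) := by
  have h := (tendsto_qPoch q hq).inv₀ (qPoch_ne_zero hq hq)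
  have h1 : Tendsto Int.toNat atTop atTop :=
    tendsto_atTop.2 fun b => (eventually_ge_atTop (b : ℤ)).mono fun m hm => by omega
  refine (h.comp h1).congr' ?_
  filter_upwards [eventually_ge_atTop 0] with m hm
  simp [invPoch, not_lt.2 hm]

lemma exists_bound_invPoch (hq : ‖q‖ < 1) : ∃ C, ∀ m, ‖invPoch q m‖ ≤ C := by
  have h := (tendsto_qPoch q hq).inv₀ (qPoch_ne_zero hq hq)
  obtain ⟨C, hC⟩ := h.norm.bddAbove_range
  refine ⟨C, fun m => ?_⟩
  have hC' := fun n => hC ⟨n, rfl⟩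
  rw [invPoch]
  split_ifs
  · rw [norm_zero]; exact (norm_nonneg _).trans (hC' 0)
  · exact hC' m.toNat

/-- The Jacobi triple product. -/
theorem theta_eq_qPoch {x : ℂ} (hx : x ≠ 0) (hq0 : q ≠ 0) (hq : ‖q‖ < 1) :
    theta x q = qPoch q q * qPoch x q * qPoch (q / x) q := by
  have hJ := qPoch_ne_zero hq hq
  obtain ⟨C, hC⟩ := exists_bound_invPoch hq
  obtain ⟨D, hD⟩ := (tendsto_qPoch q hq).norm.bddAbove_range
  have hD' := fun n => hD ⟨n, rfl⟩
  have hC0 : 0 ≤ C := (norm_nonneg _).trans (hC 0)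
  have hD0 : 0 ≤ D := (norm_nonneg _).trans (hD' 0)
  -- Dominated convergence: the Gaussian binomials are bounded uniformly in `n` and `j`, and for
  -- fixed `j` tend to `1 / (q; q)`.
  have key : Tendsto (fun n : ℕ => ∑' j : ℤ, (∏ k ∈ range (2 * n), (1 - q * q ^ k)) *
      (invPoch q (n - j) * invPoch q (n + j)) * thetaTerm x q j) atTop
      (𝓝 (∑' j : ℤ, qPoch q q * ((qPoch q q)⁻¹ * (qPoch q q)⁻¹) * thetaTerm x q j)) := by
    refine tendsto_tsum_of_dominated_convergence
      (bound := fun j => D * (C * C) * ‖thetaTerm x q j‖)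
      ((summable_norm_thetaTerm hx hq0 hq).mul_left _) (fun j => ?_)
      (Eventually.of_forall fun n j => ?_)
    · refine Tendsto.mul_const _ (Tendsto.mul ?_ (Tendsto.mul ?_ ?_))
      · exact (tendsto_qPoch q hq).comp (tendsto_id.const_mul_atTop' two_pos)
      · refine (tendsto_invPoch hq).comp ?_
        exact tendsto_atTop_add_const_right _ (-j) tendsto_natCast_atTop_atTop
      · refine (tendsto_invPoch hq).comp ?_
        exact tendsto_atTop_add_const_right _ j tendsto_natCast_atTop_atTop
    · rw [norm_mul, norm_mul, norm_mul]
      have h1 := hD' (2 * n)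
      have h2 := hC (n - j)
      have h3 := hC (n + j)
      simp only at h1
      gcongr
  have key2 : Tendsto (fun n : ℕ => (∏ k ∈ range n, (1 - x * q ^ k)) *
      ∏ k ∈ range n, (1 - q / x * q ^ k)) atTop (𝓝 (qPoch x q * qPoch (q / x) q)) :=
    (tendsto_qPoch x hq).mul (tendsto_qPoch (q / x) hq)
  simp_rw [(hasSum_finite_tripleProduct hx hq0 hq _).tsum_eq] at key
  have h := tendsto_nhds_unique key key2
  rw [tsum_mul_left, ← theta_eq_tsum] at h
  rw [mul_assoc, ← h]
  field_simp

end TripleProduct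

/-! ### Laurent coefficients of the reciprocal theta function -/

section Appell

variable {q : ℂ}

/-- The reflection `n ↦ 1 - 2k - n` preserves the exponent of `q` and reverses the sign, so the
series equals its own negative. -/
lemma theta_zpow_eq_zero (hq0 : q ≠ 0) (hq : ‖q‖ < 1) (k : ℤ) : theta (q ^ k) q = 0 := by
  have h := hasSum_theta (zpow_ne_zero k hq0) hq0 hq
  have h2 := (Equiv.subLeft (1 - 2 * k)).hasSum_iff.2 h
  have h3 : thetaTerm (q ^ k) q ∘ Equiv.subLeft (1 - 2 * k) = fun n => -thetaTerm (q ^ k) q n := by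
    funext n
    simp only [Function.comp_apply, Equiv.subLeft_apply, thetaTerm, ← zpow_mul]
    have e1 : (-1 : ℂ) ^ (1 - 2 * k - n) = -(-1 : ℂ) ^ n := by
      rw [zpow_sub₀ (by norm_num), zpow_sub₀ (by norm_num), zpow_mul]
      norm_num
      rw [div_eq_mul_inv, ← inv_zpow]; norm_num
    rw [e1, mul_assoc, mul_assoc, ← zpow_add₀ hq0, ← zpow_add₀ hq0, neg_mul]
    congr 3
    have h1 := two_mul_triangle (1 - 2 * k - n)
    have h2 := two_mul_triangle n
    linarith
  rw [h3] at h2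
  have h4 := h2.add h
  simp only [neg_add_cancel] at h4
  have h5 := h4.unique hasSum_zero
  have h6 : (2 : ℂ) * theta (q ^ k) q = 0 := by rw [two_mul]; exact h5
  simpa using h6

/-- The `s`-th Laurent coefficient of the reciprocal theta function on `‖q‖ < ‖w‖ < 1`, up to
the constant factor `(q; q)_∞ ^ 3`. -/
noncomputable def recipCoeff (q : ℂ) (s : ℤ) : ℂ := ∑' r : ℕ, thetaTerm (q ^ (s + 1)) q r

lemma hasSum_recipCoeff (hq0 : q ≠ 0) (hq : ‖q‖ < 1) (s : ℤ) :
    HasSum (fun r : ℕ => thetaTerm (q ^ (s + 1)) q r) (recipCoeff q s) :=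
  (summable_norm_thetaTerm_nat (zpow_ne_zero _ hq0) hq0 hq).of_norm.hasSum

lemma thetaTerm_neg_succ_zpow (hq0 : q ≠ 0) (s : ℤ) (r : ℕ) :
    thetaTerm (q ^ (s + 1)) q (-((r : ℤ) + 1)) =
      -(q ^ (-s) * thetaTerm (q ^ (-s + 1)) q r) := by
  rw [thetaTerm_neg hq0]
  have e : q / q ^ (s + 1) = q ^ (-s) := by
    rw [zpow_add₀ hq0, zpow_neg, zpow_one]; field_simp
  rw [e, thetaTerm_succ (zpow_ne_zero _ hq0) hq0]
  simp only [thetaTerm, ← zpow_mul]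
  rw [add_mul (-s) 1, zpow_add₀ hq0, one_mul]
  ring

/-- The two halves of a vanishing theta series are opposite. This is what later joins the quadrant
`r, s < 0` to the quadrant `r, s ≥ 0`. -/
lemma recipCoeff_eq_neg_tsum (hq0 : q ≠ 0) (hq : ‖q‖ < 1) (s : ℤ) :
    HasSum (fun r : ℕ => thetaTerm (q ^ (s + 1)) q (-((r : ℤ) + 1))) (-recipCoeff q s) := by
  have h := theta_zpow_eq_zero hq0 hq (s + 1)
  have hs := (summable_norm_thetaTerm (zpow_ne_zero (s + 1) hq0) hq0 hq).of_norm
  have h1 : Summable fun r : ℕ => thetaTerm (q ^ (s + 1)) q (-((r : ℤ) + 1)) := by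
    refine hs.comp_injective (i := fun r : ℕ => -((r : ℤ) + 1)) fun a b hab => ?_
    simpa using hab
  have h2 := (HasSum.of_nat_of_neg_add_one (hasSum_recipCoeff hq0 hq s) h1.hasSum).tsum_eq
  rw [← theta_eq_tsum, h] at h2
  have h3 : (∑' r : ℕ, thetaTerm (q ^ (s + 1)) q (-((r : ℤ) + 1))) = -recipCoeff q s := by
    linear_combination -h2
  rw [← h3]
  exact h1.hasSum

/-- The negative half of the series at `q^(s+1)` is, term by term, a multiple of the nonnegative
half at `q^(-s+1)`. This gives the decay of the coefficients as `s → -∞`. -/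
lemma recipCoeff_neg (hq0 : q ≠ 0) (hq : ‖q‖ < 1) (s : ℤ) :
    recipCoeff q s = q ^ (-s) * recipCoeff q (-s) := by
  have h := recipCoeff_eq_neg_tsum hq0 hq s
  simp_rw [thetaTerm_neg_succ_zpow hq0] at h
  have h2 := ((hasSum_recipCoeff hq0 hq (-s)).mul_left (q ^ (-s))).neg
  exact neg_injective (h.unique h2)

/-- Split off the term `r = 0` and shift `r` by one. -/
lemma recipCoeff_eq_one_sub (hq0 : q ≠ 0) (hq : ‖q‖ < 1) (s : ℤ) :
    recipCoeff q s = 1 - q ^ (s + 1) * recipCoeff q (s + 1) := by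
  have h := hasSum_recipCoeff hq0 hq s
  have h2 := (hasSum_nat_add_iff' 1).2 h
  have h3 := ((hasSum_recipCoeff hq0 hq (s + 1)).mul_left (q ^ (s + 1))).neg
  have e : (fun n : ℕ => thetaTerm (q ^ (s + 1)) q ((n + 1 : ℕ) : ℤ)) =
      fun n : ℕ => -(q ^ (s + 1) * thetaTerm (q ^ (s + 1 + 1)) q n) := by
    funext n
    push_cast
    rw [thetaTerm_succ (zpow_ne_zero _ hq0) hq0]
    simp only [thetaTerm, ← zpow_mul]
    rw [add_mul (s + 1) 1, zpow_add₀ hq0 ((s + 1) * n), one_mul]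
    ring
  rw [e] at h2
  have h4 := h2.unique h3
  simp [thetaTerm] at h4
  linear_combination h4

lemma norm_thetaTerm_zpow_le (hq0 : q ≠ 0) (hq : ‖q‖ < 1) {s : ℤ} (hs : 0 ≤ s) (r : ℕ) :
    ‖thetaTerm (q ^ (s + 1)) q r‖ ≤ ‖thetaTerm q q r‖ := by
  simp only [thetaTerm, norm_mul, ← zpow_mul, norm_zpow]
  refine mul_le_mul_of_nonneg_left ?_ (by positivity)
  refine zpow_le_zpow_right_of_le_one₀ (by simpa using hq0) hq.le ?_
  nlinarith [mul_nonneg hs (Int.natCast_nonneg r)]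

lemma exists_norm_recipCoeff_le (hq0 : q ≠ 0) (hq : ‖q‖ < 1) :
    ∃ C, 0 ≤ C ∧ (∀ s : ℕ, ‖recipCoeff q s‖ ≤ C) ∧
      ∀ s : ℕ, ‖recipCoeff q (-s)‖ ≤ C * ‖q‖ ^ s := by
  have hs := summable_norm_thetaTerm_nat hq0 hq0 hq
  have h1 : ∀ s : ℕ, ‖recipCoeff q s‖ ≤ ∑' r : ℕ, ‖thetaTerm q q r‖ := fun s =>
    tsum_of_norm_bounded hs.hasSum fun r => norm_thetaTerm_zpow_le hq0 hq (Int.natCast_nonneg s) r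
  refine ⟨_, tsum_nonneg fun r => norm_nonneg _, h1, fun s => ?_⟩
  rw [recipCoeff_neg hq0 hq, neg_neg, norm_mul, zpow_natCast, norm_pow, mul_comm]
  exact mul_le_mul_of_nonneg_right (h1 s) (by positivity)

lemma summable_norm_recipCoeff_mul_zpow (hq0 : q ≠ 0) (hq : ‖q‖ < 1) {w : ℂ} (h1 : ‖q‖ < ‖w‖)
    (h2 : ‖w‖ < 1) : Summable fun s : ℤ => ‖recipCoeff q s * w ^ s‖ := by
  obtain ⟨C, hC0, hC1, hC2⟩ := exists_norm_recipCoeff_le hq0 hq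
  have hw : 0 < ‖w‖ := (norm_nonneg _).trans_lt h1
  refine Summable.of_nat_of_neg ?_ ?_
  · refine Summable.of_nonneg_of_le (fun _ => norm_nonneg _) (fun s => ?_)
      ((summable_geometric_of_lt_one hw.le h2).mul_left C)
    rw [norm_mul, zpow_natCast, norm_pow]
    exact mul_le_mul_of_nonneg_right (hC1 s) (by positivity)
  · refine Summable.of_nonneg_of_le (fun _ => norm_nonneg _) (fun s => ?_)
      ((summable_geometric_of_lt_one (by positivity) ((div_lt_one hw).2 h1)).mul_left C)
    rw [norm_mul, zpow_neg, zpow_natCast, norm_inv, norm_pow, div_pow, div_eq_mul_inv, ← mul_assoc]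
    exact mul_le_mul_of_nonneg_right (hC2 s) (by positivity)

/-- The Laurent series `∑ a_s w ^ s` with the coefficients `recipCoeff`. -/
noncomputable def recipSeries (q w : ℂ) : ℂ := ∑' s : ℤ, recipCoeff q s * w ^ s

/-- The constant coefficient of `θ(w; q) * recipSeries q w`. -/
noncomputable def recipConst (q : ℂ) : ℂ := ∑' n : ℤ, thetaTerm 1 q n * recipCoeff q (-n)

lemma thetaTerm_eq_mul (x q : ℂ) (n : ℤ) : thetaTerm x q n = thetaTerm 1 q n * x ^ n := by
  simp [thetaTerm]

/-- Substituting `recipCoeff_eq_one_sub`, the constant `1` contributes `θ(1; q) = 0` and the rest is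
the same sum shifted by one, times `q^N`. The sum `g` thus satisfies `g = q^N g`, and `q^N ≠ 1` for
`N ≠ 0`. -/
lemma convolution_eq_zero (hq0 : q ≠ 0) (hq : ‖q‖ < 1) {N : ℤ} (hN : N ≠ 0)
    (hs : Summable fun n : ℤ => thetaTerm 1 q n * recipCoeff q (N - n)) :
    ∑' n : ℤ, thetaTerm 1 q n * recipCoeff q (N - n) = 0 := by
  have h := hs.hasSum
  set g := ∑' n : ℤ, thetaTerm 1 q n * recipCoeff q (N - n)
  have h1 := (Equiv.subRight (1 : ℤ)).hasSum_iff.2 h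
  have h2 : HasSum (thetaTerm 1 q) 0 := by
    have := hasSum_theta one_ne_zero hq0 hq
    rwa [← zpow_zero q, theta_zpow_eq_zero hq0 hq, zpow_zero] at this
  have h3 := h2.add (h1.mul_left (q ^ N))
  have e : (fun n : ℤ => thetaTerm 1 q n + q ^ N *
      ((fun n : ℤ => thetaTerm 1 q n * recipCoeff q (N - n)) ∘ Equiv.subRight (1 : ℤ)) n) =
      fun n : ℤ => thetaTerm 1 q n * recipCoeff q (N - n) := by
    funext n
    have t := thetaTerm_succ (one_ne_zero (α := ℂ)) hq0 (n - 1)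
    rw [sub_add_cancel] at t
    simp only [Function.comp_apply, Equiv.subRight_apply]
    rw [recipCoeff_eq_one_sub hq0 hq (N - n), t, show N - (n - 1) = N - n + 1 by ring,
      show q ^ N = q ^ (n - 1) * q ^ (N - n + 1) by rw [← zpow_add₀ hq0]; congr 1; ring]
    ring
  rw [e, zero_add] at h3
  have h4 := h3.unique h
  have h5 : q ^ N ≠ 1 := by
    intro h6
    have h7 : ‖q‖ ^ N = 1 := by rw [← norm_zpow, h6, norm_one]
    rw [zpow_eq_one_iff_right₀ (norm_nonneg _) hq.ne] at h7
    exact hN h7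
  have h6 : (q ^ N - 1) * g = 0 := by linear_combination h4
  exact (mul_eq_zero.1 h6).resolve_left (sub_ne_zero.2 h5)

/-- In the Cauchy product of the two Laurent series every coefficient except the constant one
vanishes, so the product does not depend on `w`. -/
lemma theta_mul_recipSeries (hq0 : q ≠ 0) (hq : ‖q‖ < 1) {w : ℂ} (h1 : ‖q‖ < ‖w‖)
    (h2 : ‖w‖ < 1) : theta w q * recipSeries q w = recipConst q := by
  have hw : w ≠ 0 := norm_pos_iff.1 ((norm_nonneg _).trans_lt h1)
  have s1 := summable_norm_thetaTerm hw hq0 hq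
  have s2 := summable_norm_recipCoeff_mul_zpow hq0 hq h1 h2
  rw [theta_eq_tsum, recipSeries, tsum_mul_tsum_of_summable_norm s1 s2]
  have s3 := summable_mul_of_summable_norm s1 s2
  let e : ℤ × ℤ ≃ ℤ × ℤ :=
    ⟨fun p => (p.2, p.1 - p.2), fun p => (p.1 + p.2, p.1), fun p => by simp, fun p => by simp⟩
  have s4 := e.summable_iff.2 s3
  have s5 := s4.tsum_prod
  simp only [Function.comp_apply] at s5
  rw [← e.tsum_eq, s5, tsum_eq_single 0]
  · simp only [e, Equiv.coe_fn_mk, zero_sub, recipConst]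
    refine tsum_congr fun n => ?_
    rw [thetaTerm_eq_mul w, zpow_neg]
    have := zpow_ne_zero n hw
    field_simp
  · intro N hN
    have e1 : ∀ n : ℤ, thetaTerm w q n * (recipCoeff q (N - n) * w ^ (N - n)) =
        w ^ N * (thetaTerm 1 q n * recipCoeff q (N - n)) := fun n => by
      rw [thetaTerm_eq_mul w, zpow_sub₀ hw]
      have := zpow_ne_zero n hw
      field_simp
    have s5 := s4.prod_factor N
    simp only [e, Equiv.coe_fn_mk, Function.comp_apply, e1] at s5 ⊢
    rw [tsum_mul_left, convolution_eq_zero hq0 hq hN, mul_zero]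
    exact (summable_mul_left_iff (zpow_ne_zero N hw)).1 s5

end Appell

/-! ### The constant `(q; q)^3`, from the limit `w → 1` -/

section RecipConst

variable {q : ℂ}

lemma continuous_qPoch (hq : ‖q‖ < 1) : Continuous fun x => qPoch x q := by
  rw [continuous_iff_continuousAt]
  intro x
  have hu : Summable fun n : ℕ => (‖x‖ + 1) * ‖q‖ ^ n :=
    (summable_geometric_of_lt_one (norm_nonneg _) hq).mul_left _
  have h := Summable.hasProdLocallyUniformlyOn_nat_one_add (f := fun (n : ℕ) (y : ℂ) => -(y * q ^ n))
    (K := Metric.ball (0 : ℂ) (‖x‖ + 1)) Metric.isOpen_ball hu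
    (Eventually.of_forall fun n y hy => by
      rw [norm_neg, norm_mul, norm_pow]
      exact mul_le_mul_of_nonneg_right (mem_ball_zero_iff.1 hy).le (by positivity))
    (fun n => by fun_prop)
  have h2 : ContinuousOn (fun y : ℂ => ∏' n : ℕ, (1 + -(y * q ^ n)))
      (Metric.ball (0 : ℂ) (‖x‖ + 1)) :=
    TendstoLocallyUniformlyOn.continuousOn h
      (Frequently.of_forall fun s => continuousOn_finsetProd _ fun n _ => by fun_prop)
  have h3 := h2.continuousAt (Metric.isOpen_ball.mem_nhds
    (by rw [mem_ball_zero_iff]; linarith : x ∈ Metric.ball (0 : ℂ) (‖x‖ + 1)))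
  simpa [qPoch, sub_eq_add_neg] using h3

lemma hasSum_indicator_zpow {w : ℂ} (hw : ‖w‖ < 1) :
    HasSum (fun s : ℤ => if 0 ≤ s then w ^ s else 0) (1 - w)⁻¹ := by
  have h1 : HasSum (fun n : ℕ => if 0 ≤ (n : ℤ) then w ^ (n : ℤ) else 0) (1 - w)⁻¹ :=
    (hasSum_geometric_of_norm_lt_one hw).congr_fun fun n => by
      rw [if_pos (Int.natCast_nonneg n), zpow_natCast]
  have h2 : HasSum (fun n : ℕ => if 0 ≤ -((n : ℤ) + 1) then w ^ (-((n : ℤ) + 1)) else 0) 0 :=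
    hasSum_zero.congr_fun fun n => if_neg (by omega)
  have h := HasSum.of_nat_of_neg_add_one (f := fun s : ℤ => if 0 ≤ s then w ^ s else 0) h1 h2
  rwa [add_zero] at h

/-- Near `w = 1` the series behaves like the pole `1 / (1 - w)`. For `s ≥ 0` the difference of
coefficients is `-q^(s+1) recipCoeff q (s+1)`, and for `s < 0` the coefficient is `O(|q|^|s|)`; both
are dominated by a multiple of `(|q|/ρ)^|s|`, uniformly in `w`. -/
lemma exists_norm_recipSeries_sub_le (hq0 : q ≠ 0) (hq : ‖q‖ < 1) {ρ : ℝ} (h1 : ‖q‖ < ρ) :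
    ∃ D, ∀ w : ℂ, ρ ≤ ‖w‖ → ‖w‖ < 1 → ‖recipSeries q w - (1 - w)⁻¹‖ ≤ D := by
  obtain ⟨C, hC0, hC1, hC2⟩ := exists_norm_recipCoeff_le hq0 hq
  have hρ : 0 < ρ := (norm_nonneg _).trans_lt h1
  have hb : Summable fun s : ℤ => C * (‖q‖ / ρ) ^ s.natAbs := by
    refine Summable.mul_left _ (Summable.of_nat_of_neg ?_ ?_) <;>
    simpa using summable_geometric_of_lt_one (by positivity) ((div_lt_one hρ).2 h1)
  refine ⟨∑' s : ℤ, C * (‖q‖ / ρ) ^ s.natAbs, fun w hw1 hw2 => ?_⟩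
  have hw0 : 0 < ‖w‖ := hρ.trans_le hw1
  have hs := (summable_norm_recipCoeff_mul_zpow hq0 hq (h1.trans_le hw1) hw2).of_norm.hasSum.sub
    (hasSum_indicator_zpow hw2)
  rw [recipSeries, ← hs.tsum_eq]
  refine tsum_of_norm_bounded hb.hasSum fun s => ?_
  rcases Int.eq_nat_or_neg s with ⟨n, rfl | rfl⟩
  · rw [if_pos (Int.natCast_nonneg n), recipCoeff_eq_one_sub hq0 hq]
    have e : (1 - q ^ ((n : ℤ) + 1) * recipCoeff q ((n : ℤ) + 1)) * w ^ (n : ℤ) - w ^ (n : ℤ) =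
        -(recipCoeff q ((n + 1 : ℕ) : ℤ) * (q ^ (n + 1) * w ^ n)) := by
      rw [← zpow_natCast q]; push_cast; rw [← zpow_natCast w]; ring
    rw [e, norm_neg, norm_mul, norm_mul, norm_pow, norm_pow, Int.natAbs_natCast]
    refine mul_le_mul (hC1 _) ?_ (by positivity) hC0
    rw [div_pow]
    have hρ1 : ρ ^ n ≤ 1 := pow_le_one₀ hρ.le (hw1.trans hw2.le)
    have hw3 : ‖w‖ ^ n ≤ 1 := pow_le_one₀ hw0.le hw2.le
    have hq3 : ‖q‖ ^ (n + 1) ≤ ‖q‖ ^ n := pow_le_pow_of_le_one (norm_nonneg _) hq.le n.le_succ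
    calc ‖q‖ ^ (n + 1) * ‖w‖ ^ n ≤ ‖q‖ ^ n * 1 := by gcongr
      _ = ‖q‖ ^ n := mul_one _
      _ ≤ ‖q‖ ^ n / ρ ^ n := le_div_self (by positivity) (by positivity) hρ1
  -- The index `0` recurs here as `-0`, where the geometric series still contributes its term `1`.
  · rcases Nat.eq_zero_or_pos n with rfl | hn
    · have := recipCoeff_eq_one_sub hq0 hq 0
      have h3 := hC1 1
      simp only [Nat.cast_one] at h3
      simp only [Nat.cast_zero, neg_zero, this, le_refl, if_true, zpow_zero, zero_add, zpow_one,
        Int.natAbs_zero, pow_zero, mul_one]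
      rw [sub_sub_cancel_left, norm_neg, norm_mul]
      nlinarith [norm_nonneg q, norm_nonneg (recipCoeff q 1)]
    · rw [if_neg (by omega), sub_zero, norm_mul, Int.natAbs_neg, Int.natAbs_natCast, zpow_neg,
        zpow_natCast, norm_inv, norm_pow, div_pow, div_eq_mul_inv, ← mul_assoc]
      have h3 := hC2 n
      gcongr

/-- The constant coefficient of `θ(w; q) * recipSeries q w` is `(q; q)_∞ ^ 3`. -/
lemma recipConst_eq (hq0 : q ≠ 0) (hq : ‖q‖ < 1) : recipConst q = qPoch q q ^ 3 := by
  obtain ⟨ρ, hρ1, hρ2⟩ := exists_between hq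
  have hρ0 : 0 < ρ := (norm_nonneg _).trans_lt hρ1
  obtain ⟨D, hD⟩ := exists_norm_recipSeries_sub_le hq0 hq hρ1
  have hmem : ∀ᶠ r : ℝ in 𝓝[<] 1, ρ < r ∧ r < 1 := Ioo_mem_nhdsLT hρ2
  have hr : Tendsto (fun r : ℝ => (r : ℂ)) (𝓝[<] 1) (𝓝 1) := by
    have : Tendsto (fun r : ℝ => (r : ℂ)) (𝓝 1) (𝓝 ((1 : ℝ) : ℂ)) :=
      Complex.continuous_ofReal.tendsto 1
    rw [Complex.ofReal_one] at this
    exact this.mono_left nhdsWithin_le_nhds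
  -- The zero of `θ(w; q)` at `w = 1` cancels the pole: `(1 - r)` times the series tends to `1`, and
  -- the other triple product factors tend to `(q; q)^3`.
  have h1 : Tendsto (fun r : ℝ => (1 - (r : ℂ)) * (recipSeries q r - (1 - (r : ℂ))⁻¹)) (𝓝[<] 1)
      (𝓝 0) := by
    have h2 : Tendsto (fun r : ℝ => ‖1 - (r : ℂ)‖ * D) (𝓝[<] 1) (𝓝 0) := by
      have := ((tendsto_const_nhds (x := (1 : ℂ))).sub hr).norm.mul_const D
      simpa using this
    refine squeeze_zero_norm' ?_ h2
    filter_upwards [hmem] with r hr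
    rw [norm_mul]
    have h3 : ‖(r : ℂ)‖ = r := by
      rw [Complex.norm_real, Real.norm_of_nonneg (hρ0.trans hr.1).le]
    exact mul_le_mul_of_nonneg_left (hD r (by rw [h3]; exact hr.1.le) (by rw [h3]; exact hr.2)) (norm_nonneg _)
  have h2 : Tendsto (fun r : ℝ => qPoch q q * qPoch ((r : ℂ) * q) q * qPoch (q / (r : ℂ)) q *
      (1 + (1 - (r : ℂ)) * (recipSeries q r - (1 - (r : ℂ))⁻¹))) (𝓝[<] 1)
      (𝓝 (qPoch q q * qPoch (1 * q) q * qPoch (q / 1) q * (1 + 0))) := by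
    refine Tendsto.mul (Tendsto.mul (tendsto_const_nhds.mul ?_) ?_) (tendsto_const_nhds.add h1)
    · exact ((continuous_qPoch hq).tendsto _).comp (hr.mul_const q)
    · exact ((continuous_qPoch hq).tendsto _).comp (tendsto_const_nhds.div hr one_ne_zero)
  have h3 : Tendsto (fun _ : ℝ => recipConst q) (𝓝[<] 1)
      (𝓝 (qPoch q q * qPoch (1 * q) q * qPoch (q / 1) q * (1 + 0))) := by
    refine h2.congr' ?_
    filter_upwards [hmem] with r hr
    have h3 : ‖(r : ℂ)‖ = r := by
      rw [Complex.norm_real, Real.norm_of_nonneg (hρ0.trans hr.1).le]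
    have hr0 : (r : ℂ) ≠ 0 := by exact_mod_cast (hρ0.trans hr.1).ne'
    have hr1 : 1 - (r : ℂ) ≠ 0 := by
      rw [sub_ne_zero]; exact_mod_cast hr.2.ne'
    rw [← theta_mul_recipSeries hq0 hq (w := r) (by rw [h3]; exact hρ1.trans hr.1)
      (by rw [h3]; exact hr.2), theta_eq_qPoch hr0 hq0 hq, qPoch_eq_mul (r : ℂ) hq]
    field_simp
    ring
  rw [tendsto_nhds_unique tendsto_const_nhds h3]
  simp
  ring

end RecipConst

/-! ### Constant terms of Laurent series on the unit circle -/

section ConstantTerm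

open Complex MeasureTheory intervalIntegral

lemma integral_exp_two_pi_int (d : ℤ) :
    ∫ x in (0 : ℝ)..1, exp (2 * Real.pi * I * (x : ℂ)) ^ d = if d = 0 then 1 else 0 := by
  split_ifs with h
  · simp [h]
  · have hc : 2 * Real.pi * I * (d : ℂ) ≠ 0 := by
      simp [h, Real.pi_ne_zero]
    have e : ∀ x : ℝ, exp (2 * Real.pi * I * (x : ℂ)) ^ d =
        exp (2 * Real.pi * I * (d : ℂ) * (x : ℂ)) := fun x => by
      rw [← exp_int_mul]; ring_nf
    simp_rw [e]
    rw [integral_exp_mul_complex hc]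
    have : exp (2 * Real.pi * I * (d : ℂ) * ((1 : ℝ) : ℂ)) = 1 := by
      rw [exp_eq_one_iff]; exact ⟨d, by push_cast; ring⟩
    rw [this]
    simp

lemma integral_tsum_circle {ι : Type*} [Countable ι] (c : ι → ℂ) (d : ι → ℤ)
    (hc : Summable fun i => ‖c i‖) :
    ∫ x in (0 : ℝ)..1, ∑' i, c i * exp (2 * Real.pi * I * (x : ℂ)) ^ d i =
      ∑' i, if d i = 0 then c i else 0 := by
  have hn : ∀ x : ℝ, ‖exp (2 * Real.pi * I * (x : ℂ))‖ = 1 := fun x => by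
    rw [norm_exp]; simp
  have hcont : ∀ i, Continuous fun x : ℝ => c i * exp (2 * Real.pi * I * (x : ℂ)) ^ d i :=
    fun i => continuous_const.mul
      (Continuous.zpow₀ (by fun_prop) _ fun x => Or.inl (exp_ne_zero _))
  have h := tsum_intervalIntegral_eq_of_summable_norm (a := 0) (b := 1)
    (f := fun i => (⟨_, hcont i⟩ : C(ℝ, ℂ))) (Summable.of_nonneg_of_le (fun _ => norm_nonneg _)
      (fun i => (ContinuousMap.norm_le _ (norm_nonneg (c i))).2 fun x => by simp [hn]) hc)
  simp only [ContinuousMap.coe_mk] at h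
  rw [← h]
  refine tsum_congr fun i => ?_
  rw [intervalIntegral.integral_const_mul, integral_exp_two_pi_int]
  simp

/-- Two Laurent series that agree on the unit circle have the same constant term. -/
lemma constantTerm_unique {ι κ : Type*} [Countable ι] [Countable κ] {c : ι → ℂ} {d : ι → ℤ}
    {c' : κ → ℂ} {d' : κ → ℤ} (hc : Summable fun i => ‖c i‖) (hc' : Summable fun i => ‖c' i‖)
    (h : ∀ z : ℂ, ‖z‖ = 1 → ∑' i, c i * z ^ d i = ∑' k, c' k * z ^ d' k) :
    (∑' i, if d i = 0 then c i else 0) = ∑' k, if d' k = 0 then c' k else 0 := by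
  rw [← integral_tsum_circle c d hc, ← integral_tsum_circle c' d' hc']
  congr 1
  funext x
  refine h _ ?_
  rw [norm_exp]; simp

end ConstantTerm

/-! ### The double sum as a single sum over `s` -/

lemma norm_pow_lt_one {q : ℂ} (hq : ‖q‖ < 1) {n : ℕ} (hn : n ≠ 0) : ‖q ^ n‖ < 1 := by
  rw [norm_pow]; exact pow_lt_one₀ (norm_nonneg _) hq hn

/-- Pairs of natural numbers index the pairs `(r, s)` with `r, s ≥ 0`. -/
def natEquivNonnegPairs : ℕ × ℕ ≃ nonnegPairs where
  toFun p := ⟨(p.1, p.2), by simp [nonnegPairs]⟩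
  invFun p := (p.1.1.toNat, p.1.2.toNat)
  left_inv p := by simp
  right_inv p := by
    obtain ⟨⟨r, s⟩, h1, h2⟩ := p
    simp only [] at h1 h2
    ext <;> simp [h1, h2]

/-- Pairs of natural numbers index the pairs `(r, s)` with `r, s < 0`. -/
def natEquivNegPairs : ℕ × ℕ ≃ negPairs where
  toFun p := ⟨(-((p.1 : ℤ) + 1), -((p.2 : ℤ) + 1)), by simp [negPairs]; omega⟩
  invFun p := ((-p.1.1 - 1).toNat, (-p.1.2 - 1).toNat)
  left_inv p := by ext <;> simp
  right_inv p := by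
    obtain ⟨⟨r, s⟩, h1, h2⟩ := p
    simp only [] at h1 h2
    ext <;> simp <;> omega

section HeckeSum

variable {q : ℂ}

/-- Since `x = q^6` and the cross coefficient also equals `6`, the factors `x^r q^(6rs)` combine to
`(Q^(s+1))^r` with `Q = q^6`. -/
lemma heckeTerm_eq (hq0 : q ≠ 0) (r s : ℤ) :
    heckeTerm 6 6 1 (q ^ 6) (q ^ 4) q (r, s) =
      thetaTerm (q ^ 4) q s * thetaTerm ((q ^ 6) ^ (s + 1)) (q ^ 6) r := by
  simp only [heckeTerm, thetaTerm]
  rw [zpow_add₀ (by norm_num : (-1 : ℂ) ≠ 0)]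
  have h1 : ((q ^ 6) ^ (s + 1)) ^ r = (q ^ 6) ^ r * q ^ (6 * r * s) := by
    rw [← zpow_mul, add_mul, zpow_add₀ (pow_ne_zero _ hq0), one_mul, ← zpow_natCast q 6,
      ← zpow_mul, ← zpow_mul, mul_comm]
    congr 2
    push_cast
    ring
  have h2 : (q ^ 6) ^ (r * (r - 1) / 2) = q ^ (6 * (r * (r - 1) / 2)) := by
    rw [← zpow_natCast q 6, ← zpow_mul]; rfl
  rw [h1, h2, zpow_add₀ hq0, zpow_add₀ hq0, one_mul]
  ring

lemma summable_hecke_nonneg (hq0 : q ≠ 0) (hq : ‖q‖ < 1) :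
    Summable fun p : ℕ × ℕ => ‖heckeTerm 6 6 1 (q ^ 6) (q ^ 4) q ((p.1 : ℤ), (p.2 : ℤ))‖ := by
  have hQ0 : q ^ 6 ≠ 0 := pow_ne_zero _ hq0
  have hQ : ‖q ^ 6‖ < 1 := norm_pow_lt_one hq (by norm_num)
  have h := (summable_norm_thetaTerm_nat hQ0 hQ0 hQ).mul_of_nonneg
    (summable_norm_thetaTerm_nat (pow_ne_zero 4 hq0) hq0 hq) (fun _ => norm_nonneg _)
    (fun _ => norm_nonneg _)
  refine Summable.of_nonneg_of_le (fun _ => norm_nonneg _) (fun p => ?_) h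
  rw [heckeTerm_eq hq0, norm_mul, mul_comm]
  exact mul_le_mul_of_nonneg_right
    (norm_thetaTerm_zpow_le hQ0 hQ (Int.natCast_nonneg _) _) (norm_nonneg _)

lemma summable_hecke_neg (hq0 : q ≠ 0) (hq : ‖q‖ < 1) :
    Summable fun p : ℕ × ℕ =>
      ‖heckeTerm 6 6 1 (q ^ 6) (q ^ 4) q (-((p.1 : ℤ) + 1), -((p.2 : ℤ) + 1))‖ := by
  have hQ0 : q ^ 6 ≠ 0 := pow_ne_zero _ hq0
  have hQ : ‖q ^ 6‖ < 1 := norm_pow_lt_one hq (by norm_num)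
  have hc : Summable fun s : ℕ => ‖thetaTerm (q ^ 4) q (-((s : ℤ) + 1))‖ := by
    refine (summable_norm_thetaTerm (pow_ne_zero 4 hq0) hq0 hq).comp_injective
      (i := fun s : ℕ => -((s : ℤ) + 1)) fun a b hab => ?_
    simpa using hab
  have h := (summable_norm_thetaTerm_nat hQ0 hQ0 hQ).mul_of_nonneg hc
    (fun _ => norm_nonneg _) (fun _ => norm_nonneg _)
  refine Summable.of_nonneg_of_le (fun _ => norm_nonneg _) (fun p => ?_) h
  -- Reflecting the index `r < 0` replaces a large negative power of `Q` by a small factor times a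
  -- term with a nonnegative index.
  rw [heckeTerm_eq hq0, norm_mul, mul_comm, thetaTerm_neg_succ_zpow hQ0, norm_neg, norm_mul]
  refine mul_le_mul_of_nonneg_right ?_ (norm_nonneg _)
  rw [neg_neg]
  have h1 : ‖(q ^ 6) ^ ((p.2 : ℤ) + 1)‖ ≤ 1 := by
    rw [← Nat.cast_succ, zpow_natCast, norm_pow]
    exact pow_le_one₀ (norm_nonneg _) hQ.le
  have h2 := norm_thetaTerm_zpow_le hQ0 hQ (s := (p.2 : ℤ) + 1) (by positivity) p.1
  calc _ ≤ 1 * _ := mul_le_mul_of_nonneg_right h1 (norm_nonneg _)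
    _ ≤ _ := by rw [one_mul]; exact h2

/-- The double series `f_{6,6,1}(q^6, q^4, q)` converges absolutely. -/
lemma heckeSummable (hq0 : q ≠ 0) (hq : ‖q‖ < 1) : HeckeSummable 6 6 1 (q ^ 6) (q ^ 4) q :=
  ⟨natEquivNonnegPairs.summable_iff.1 (summable_hecke_nonneg hq0 hq).of_norm,
    natEquivNegPairs.summable_iff.1 (summable_hecke_neg hq0 hq).of_norm⟩

lemma heckeSum_eq_tsum_recipCoeff (hq0 : q ≠ 0) (hq : ‖q‖ < 1) :
    heckeSum 6 6 1 (q ^ 6) (q ^ 4) q =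
      ∑' s : ℤ, thetaTerm (q ^ 4) q s * recipCoeff (q ^ 6) s := by
  have hQ0 : q ^ 6 ≠ 0 := pow_ne_zero _ hq0
  have hQ : ‖q ^ 6‖ < 1 := norm_pow_lt_one hq (by norm_num)
  have h1 : HasSum (fun s : ℕ => thetaTerm (q ^ 4) q s * recipCoeff (q ^ 6) s)
      (∑' p : nonnegPairs, heckeTerm 6 6 1 (q ^ 6) (q ^ 4) q p) := by
    have h := (natEquivNonnegPairs.hasSum_iff.2 (heckeSummable hq0 hq).1.hasSum)
    refine ((Equiv.prodComm ℕ ℕ).hasSum_iff.2 h).prod_fiberwise fun s => ?_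
    refine ((hasSum_recipCoeff hQ0 hQ s).mul_left _).congr_fun fun r => ?_
    exact heckeTerm_eq hq0 r s
  have h2 : HasSum (fun s : ℕ => thetaTerm (q ^ 4) q (-((s : ℤ) + 1)) *
      recipCoeff (q ^ 6) (-((s : ℤ) + 1)))
      (-∑' p : negPairs, heckeTerm 6 6 1 (q ^ 6) (q ^ 4) q p) := by
    have h := (natEquivNegPairs.hasSum_iff.2 (heckeSummable hq0 hq).2.hasSum)
    refine (((Equiv.prodComm ℕ ℕ).hasSum_iff.2 h).neg).prod_fiberwise fun s => ?_
    have h3 := (recipCoeff_eq_neg_tsum hQ0 hQ (-((s : ℤ) + 1))).neg.mul_left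
      (thetaTerm (q ^ 4) q (-((s : ℤ) + 1)))
    rw [neg_neg] at h3
    refine h3.congr_fun fun r => ?_
    rw [mul_neg, ← heckeTerm_eq hq0]
    rfl
  rw [heckeSum, sub_eq_add_neg]
  exact (HasSum.of_nat_of_neg_add_one (f := fun s : ℤ => thetaTerm (q ^ 4) q s *
    recipCoeff (q ^ 6) s) h1 h2).tsum_eq.symm

end HeckeSum

/-! ### Factorization of `θ(z; q)` over base `q^6` -/

section ThetaProduct

variable {q : ℂ}

lemma qPoch_two (x : ℂ) (hq : ‖q‖ < 1) :
    qPoch x q = qPoch x (q ^ 2) * qPoch (x * q) (q ^ 2) := by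
  rw [qPoch_split x hq two_ne_zero]
  simp [prod_range_succ]

lemma qPoch_three (x : ℂ) (hq : ‖q‖ < 1) :
    qPoch x q = qPoch x (q ^ 3) * qPoch (x * q) (q ^ 3) * qPoch (x * q ^ 2) (q ^ 3) := by
  rw [qPoch_split x hq three_ne_zero]
  simp [prod_range_succ]

lemma qPoch_five (x : ℂ) (hq : ‖q‖ < 1) :
    qPoch x q = qPoch x (q ^ 5) * qPoch (x * q) (q ^ 5) * qPoch (x * q ^ 2) (q ^ 5) *
      qPoch (x * q ^ 3) (q ^ 5) * qPoch (x * q ^ 4) (q ^ 5) := by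
  rw [qPoch_split x hq (by norm_num : (5 : ℕ) ≠ 0)]
  simp [prod_range_succ]

/-- In the triple product, `(z; q)` and `(q/z; q)` are split modulo 2. The parts `(zq; q^2)` and
`(q/z; q^2)` form `θ(zq; q^2)`; the other two, split again modulo 3, pair into three theta functions
of base `q^6`. One of these is `θ(q^4/z; q^6)`, the denominator to be cancelled. -/
lemma theta_factor (hq0 : q ≠ 0) (hq : ‖q‖ < 1) {z : ℂ} (hz : z ≠ 0) :
    qPoch (q ^ 2) (q ^ 2) * qPoch (q ^ 6) (q ^ 6) ^ 3 * theta z q =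
      qPoch q q * theta (z * q) (q ^ 2) * theta z (q ^ 6) * theta (q ^ 4 / z) (q ^ 6) *
        theta (z * q ^ 4) (q ^ 6) := by
  have h2 : ‖q ^ 2‖ < 1 := norm_pow_lt_one hq (by norm_num)
  have h6 : ‖q ^ 6‖ < 1 := norm_pow_lt_one hq (by norm_num)
  have hq2 := pow_ne_zero 2 hq0
  have hq4 := pow_ne_zero 4 hq0
  have hq6 := pow_ne_zero 6 hq0
  rw [theta_eq_qPoch hz hq0 hq, theta_eq_qPoch (mul_ne_zero hz hq0) hq2 h2,
    theta_eq_qPoch hz hq6 h6, theta_eq_qPoch (div_ne_zero hq4 hz) hq6 h6,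
    theta_eq_qPoch (mul_ne_zero hz hq4) hq6 h6, qPoch_two z hq, qPoch_two (q / z) hq,
    qPoch_three z h2, qPoch_three (q / z * q) h2]
  have e1 : q ^ 2 / (z * q) = q / z := by field_simp
  have e2 : q ^ 6 / (q ^ 4 / z) = z * q ^ 2 := by field_simp
  have e3 : q ^ 6 / (z * q ^ 4) = q / z * q := by field_simp
  have e4 : q / z * q * q ^ 2 = q ^ 4 / z := by field_simp
  have e5 : q / z * q * (q ^ 2) ^ 2 = q ^ 6 / z := by field_simp
  have e6 : (q ^ 2) ^ 3 = q ^ 6 := by ring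
  have e7 : z * (q ^ 2) ^ 2 = z * q ^ 4 := by ring
  rw [e1, e2, e3, e4, e5, e6, e7]
  ring

end ThetaProduct

/-! ### The constant term as a binary theta series -/

section ConstantTermEvaluation

variable {q : ℂ}

/-- The binary theta series that arises as the constant term of a product of three theta
functions. -/
noncomputable def binaryTheta (q : ℂ) : ℂ :=
  ∑' p : ℤ × ℤ, q ^ (4 * p.1 ^ 2 + 2 * p.1 * p.2 + 4 * p.2 ^ 2 - 3 * p.1 + p.2)

lemma thetaTerm_mul (x z q : ℂ) (n : ℤ) : thetaTerm (x * z) q n = thetaTerm x q n * z ^ n := by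
  simp [thetaTerm, mul_zpow, mul_assoc]

lemma thetaTerm_pow (hq0 : q ≠ 0) (a m : ℕ) (n : ℤ) :
    thetaTerm (q ^ a) (q ^ m) n = (-1 : ℂ) ^ n * q ^ (m * (n * (n - 1) / 2) + a * n) := by
  rw [thetaTerm, zpow_add₀ hq0, zpow_mul, zpow_mul, zpow_natCast, zpow_natCast, mul_assoc]

lemma tsum_diagonal (F : ℤ × ℤ → ℂ) :
    (∑' p : ℤ × ℤ, if p.1 - p.2 = 0 then F p else 0) = ∑' s : ℤ, F (s, s) := by
  have hinj : Function.Injective fun s : ℤ => (s, s) := fun a b h => (Prod.mk.inj h).1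
  rw [← hinj.tsum_eq]
  · exact tsum_congr fun s => if_pos (sub_self s)
  · intro p hp
    rw [Function.mem_support] at hp
    refine ⟨p.1, Prod.ext rfl ?_⟩
    by_contra h
    exact hp (if_neg fun h' => h (by simp only; omega))

lemma tsum_plane (F : ℤ × ℤ × ℤ → ℂ) :
    (∑' p : ℤ × ℤ × ℤ, if p.1 + p.2.1 + p.2.2 = 0 then F p else 0) =
      ∑' p : ℤ × ℤ, F (-(p.1 + p.2), p.1, p.2) := by
  have hinj : Function.Injective fun p : ℤ × ℤ => (-(p.1 + p.2), p.1, p.2) :=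
    fun a b h => (Prod.mk.inj h).2
  rw [← hinj.tsum_eq]
  · exact tsum_congr fun p => if_pos (by simp only; ring)
  · intro p hp
    rw [Function.mem_support] at hp
    refine ⟨p.2, Prod.ext ?_ rfl⟩
    by_contra h
    exact hp (if_neg fun h' => h (by simp only; omega))

/-- The three exponents of `z` sum to zero, so the signs cancel and only the quadratic form remains.
-/
lemma thetaTerm_triple (hq0 : q ≠ 0) (m n : ℤ) :
    thetaTerm q (q ^ 2) (-(m + n)) * (thetaTerm 1 (q ^ 6) m * thetaTerm (q ^ 4) (q ^ 6) n) =
      q ^ (4 * m ^ 2 + 2 * m * n + 4 * n ^ 2 - 3 * m + n) := by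
  have e1 := thetaTerm_pow hq0 1 2 (-(m + n))
  have e2 := thetaTerm_pow hq0 0 6 m
  have e3 := thetaTerm_pow hq0 4 6 n
  rw [pow_one] at e1
  rw [pow_zero] at e2
  rw [e1, e2, e3]
  have t1 := two_mul_triangle (-(m + n))
  have t2 := two_mul_triangle m
  have t3 := two_mul_triangle n
  have hs : (-1 : ℂ) ^ (-(m + n)) * (-1 : ℂ) ^ m * (-1 : ℂ) ^ n = 1 := by
    rw [← zpow_add₀ (by norm_num), ← zpow_add₀ (by norm_num),
      show -(m + n) + m + n = 0 by ring, zpow_zero]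
  generalize -(m + n) * (-(m + n) - 1) / 2 = a at *
  generalize m * (m - 1) / 2 = b at *
  generalize n * (n - 1) / 2 = c at *
  have hexp : 4 * m ^ 2 + 2 * m * n + 4 * n ^ 2 - 3 * m + n =
      (((2 : ℕ) : ℤ) * a + ((1 : ℕ) : ℤ) * -(m + n)) +
      (((6 : ℕ) : ℤ) * b + ((0 : ℕ) : ℤ) * m) + (((6 : ℕ) : ℤ) * c + ((4 : ℕ) : ℤ) * n) := by
    push_cast
    linarith
  rw [hexp, zpow_add₀ hq0 (_ + _), zpow_add₀ hq0 (_ + _) (_ + _)]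
  generalize q ^ (((2 : ℕ) : ℤ) * a + ((1 : ℕ) : ℤ) * -(m + n)) = A
  generalize q ^ (((6 : ℕ) : ℤ) * b + ((0 : ℕ) : ℤ) * m) = B
  generalize q ^ (((6 : ℕ) : ℤ) * c + ((4 : ℕ) : ℤ) * n) = C
  linear_combination (A * B * C) * hs

lemma theta_mul_recipSeries_eq_tsum (hq0 : q ≠ 0) (hq : ‖q‖ < 1) (K : ℂ) {z : ℂ} (hz0 : z ≠ 0)
    (hw1 : ‖q ^ 6‖ < ‖q ^ 4 / z‖) (hw2 : ‖q ^ 4 / z‖ < 1) :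
    ∑' p : ℤ × ℤ, K * (thetaTerm 1 q p.1 * (recipCoeff (q ^ 6) p.2 * (q ^ 4) ^ p.2)) *
      z ^ (p.1 - p.2) = K * (theta z q * recipSeries (q ^ 6) (q ^ 4 / z)) := by
  rw [theta_eq_tsum, recipSeries, tsum_mul_tsum_of_summable_norm
    (summable_norm_thetaTerm hz0 hq0 hq) (summable_norm_recipCoeff_mul_zpow (pow_ne_zero _ hq0)
      (norm_pow_lt_one hq (by norm_num)) hw1 hw2), ← tsum_mul_left]
  refine tsum_congr fun p => ?_
  rw [thetaTerm_eq_mul z, div_zpow, zpow_sub₀ hz0]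
  ring

lemma theta_triple_eq_tsum (hq0 : q ≠ 0) (hq : ‖q‖ < 1) (K : ℂ) {z : ℂ} (hz0 : z ≠ 0) :
    ∑' p : ℤ × ℤ × ℤ, K * (thetaTerm q (q ^ 2) p.1 *
      (thetaTerm 1 (q ^ 6) p.2.1 * thetaTerm (q ^ 4) (q ^ 6) p.2.2)) * z ^ (p.1 + p.2.1 + p.2.2) =
      K * (theta (z * q) (q ^ 2) * (theta z (q ^ 6) * theta (z * q ^ 4) (q ^ 6))) := by
  have hQ0 : q ^ 6 ≠ 0 := pow_ne_zero _ hq0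
  have hQ : ‖q ^ 6‖ < 1 := norm_pow_lt_one hq (by norm_num)
  have t1 := summable_norm_thetaTerm (mul_ne_zero hz0 hq0) (pow_ne_zero 2 hq0)
    (norm_pow_lt_one hq (by norm_num))
  have t2 := summable_norm_thetaTerm hz0 hQ0 hQ
  have t3 := summable_norm_thetaTerm (mul_ne_zero hz0 (pow_ne_zero 4 hq0)) hQ0 hQ
  rw [theta_eq_tsum, theta_eq_tsum, theta_eq_tsum, tsum_mul_tsum_of_summable_norm t2 t3,
    tsum_mul_tsum_of_summable_norm t1 (t2.mul_norm t3), ← tsum_mul_left]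
  refine tsum_congr fun p => ?_
  rw [thetaTerm_eq_mul z, mul_comm z, mul_comm z, thetaTerm_mul, thetaTerm_mul,
    zpow_add₀ hz0, zpow_add₀ hz0]
  ring

/-- Both sides are constant terms of one function on `|z| = 1`. There `|q^4/z| = |q|^4` lies between
`|q^6|` and `1`, so the Laurent expansion of the reciprocal theta function applies. -/
lemma qPoch_mul_heckeSum (hq0 : q ≠ 0) (hq : ‖q‖ < 1) :
    qPoch (q ^ 2) (q ^ 2) * heckeSum 6 6 1 (q ^ 6) (q ^ 4) q = qPoch q q * binaryTheta q := by
  have hQ0 : q ^ 6 ≠ 0 := pow_ne_zero _ hq0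
  have hQ : ‖q ^ 6‖ < 1 := norm_pow_lt_one hq (by norm_num)
  have h20 : q ^ 2 ≠ 0 := pow_ne_zero _ hq0
  have h2 : ‖q ^ 2‖ < 1 := norm_pow_lt_one hq (by norm_num)
  have h40 : q ^ 4 ≠ 0 := pow_ne_zero _ hq0
  have hw1 : ‖q ^ 6‖ < ‖q ^ 4‖ := by
    rw [norm_pow, norm_pow]
    exact pow_lt_pow_right_of_lt_one₀ (norm_pos_iff.2 hq0) hq (by norm_num)
  have hw2 : ‖q ^ 4‖ < 1 := norm_pow_lt_one hq (by norm_num)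
  have s1 : Summable fun p : ℤ × ℤ => ‖qPoch (q ^ 2) (q ^ 2) *
      (thetaTerm 1 q p.1 * (recipCoeff (q ^ 6) p.2 * (q ^ 4) ^ p.2))‖ := by
    simpa only [norm_mul] using ((summable_norm_thetaTerm one_ne_zero hq0 hq).mul_norm
      (summable_norm_recipCoeff_mul_zpow hQ0 hQ hw1 hw2)).mul_left ‖qPoch (q ^ 2) (q ^ 2)‖
  have s2 : Summable fun p : ℤ × ℤ × ℤ => ‖qPoch q q * (thetaTerm q (q ^ 2) p.1 *
      (thetaTerm 1 (q ^ 6) p.2.1 * thetaTerm (q ^ 4) (q ^ 6) p.2.2))‖ := by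
    simpa only [norm_mul] using ((summable_norm_thetaTerm hq0 h20 h2).mul_norm
      ((summable_norm_thetaTerm one_ne_zero hQ0 hQ).mul_norm
        (summable_norm_thetaTerm h40 hQ0 hQ))).mul_left ‖qPoch q q‖
  have key := constantTerm_unique (d := fun p : ℤ × ℤ => p.1 - p.2)
    (d' := fun p : ℤ × ℤ × ℤ => p.1 + p.2.1 + p.2.2) s1 s2 (fun z hz => ?_)
  · rw [tsum_diagonal, tsum_plane] at key
    rw [heckeSum_eq_tsum_recipCoeff hq0 hq, binaryTheta, ← tsum_mul_left, ← tsum_mul_left]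
    simp only [thetaTerm_triple hq0] at key
    rw [← key]
    refine tsum_congr fun s => ?_
    rw [thetaTerm_eq_mul (q ^ 4)]
    ring
  · have hz0 : z ≠ 0 := norm_pos_iff.1 (hz ▸ one_pos)
    have hzw : ‖q ^ 4 / z‖ = ‖q ^ 4‖ := by rw [norm_div, hz, div_one]
    rw [theta_mul_recipSeries_eq_tsum hq0 hq _ hz0 (hzw ▸ hw1) (hzw ▸ hw2),
      theta_triple_eq_tsum hq0 hq _ hz0]
    have h3 := theta_mul_recipSeries hQ0 hQ (hzw ▸ hw1) (hzw ▸ hw2 : ‖q ^ 4 / z‖ < 1)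
    rw [recipConst_eq hQ0 hQ] at h3
    have h4 := theta_factor hq0 hq hz0
    have h5 : qPoch (q ^ 6) (q ^ 6) ^ 3 ≠ 0 := pow_ne_zero _ (qPoch_ne_zero hQ hQ)
    refine mul_left_cancel₀ h5 ?_
    linear_combination recipSeries (q ^ 6) (q ^ 4 / z) * h4 + qPoch q q *
      theta (z * q) (q ^ 2) * theta z (q ^ 6) * theta (z * q ^ 4) (q ^ 6) * h3

end ConstantTermEvaluation

/-! ### Changes of lattice variables; diagonalizing the binary theta series -/

section Lattice

/-- The determinant is `±1`, hence its own inverse, which gives the inverse map in integers without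
a case split. -/
lemma tsum_affine (F : ℤ × ℤ → ℂ) (a b c d e f : ℤ) (h : (a * d - b * c) ^ 2 = 1) :
    ∑' p : ℤ × ℤ, F (a * p.1 + b * p.2 + e, c * p.1 + d * p.2 + f) = ∑' p, F p := by
  let E : ℤ × ℤ ≃ ℤ × ℤ :=
    { toFun := fun p => (a * p.1 + b * p.2 + e, c * p.1 + d * p.2 + f)
      invFun := fun p => ((a * d - b * c) * (d * (p.1 - e) - b * (p.2 - f)),
        (a * d - b * c) * (a * (p.2 - f) - c * (p.1 - e)))
      left_inv := fun p => by
        ext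
        · simp only; linear_combination p.1 * h
        · simp only; linear_combination p.2 * h
      right_inv := fun p => by
        ext
        · simp only; linear_combination (p.1 - e) * h
        · simp only; linear_combination (p.2 - f) * h }
  exact E.tsum_eq F

lemma tsum_fst_mod (N : ℕ) [NeZero N] {F : ℤ × ℤ → ℂ} (hF : Summable F) :
    ∑' p, F p = ∑ r : Fin N, ∑' p : ℤ × ℤ, F (p.1 * N + ((r : ℕ) : ℤ), p.2) := by
  let E : Fin N × (ℤ × ℤ) ≃ ℤ × ℤ := ((Equiv.prodAssoc _ _ _).symm.trans
    ((Equiv.prodComm _ _).prodCongr (Equiv.refl _))).trans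
    ((Int.divModEquiv N).symm.prodCongr (Equiv.refl _))
  have hs := E.summable_iff.2 hF
  have h := hs.tsum_prod.trans (tsum_fintype _)
  exact (E.tsum_eq F).symm.trans h

lemma tsum_snd_mod (N : ℕ) [NeZero N] {F : ℤ × ℤ → ℂ} (hF : Summable F) :
    ∑' p, F p = ∑ r : Fin N, ∑' p : ℤ × ℤ, F (p.1, p.2 * N + ((r : ℕ) : ℤ)) := by
  have h := tsum_fst_mod N ((Equiv.prodComm ℤ ℤ).summable_iff.2 hF)
  rw [← (Equiv.prodComm ℤ ℤ).tsum_eq F]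
  refine h.trans (sum_congr rfl fun r _ => ?_)
  exact (Equiv.prodComm ℤ ℤ).tsum_eq fun p : ℤ × ℤ => F (p.1, p.2 * N + ((r : ℕ) : ℤ))

lemma triangle_two_mul (a : ℤ) : 2 * a * (2 * a - 1) / 2 = a * (2 * a - 1) := by
  rw [mul_assoc, Int.mul_ediv_cancel_left _ two_ne_zero]

lemma triangle_two_mul_add_one (a : ℤ) :
    (2 * a + 1) * (2 * a + 1 - 1) / 2 = a * (2 * a + 1) := by
  rw [show (2 * a + 1) * (2 * a + 1 - 1) = 2 * (a * (2 * a + 1)) by ring,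
    Int.mul_ediv_cancel_left _ two_ne_zero]

variable {q : ℂ}

lemma thetaTerm_neg_pow (hq0 : q ≠ 0) (a m : ℕ) (n : ℤ) :
    thetaTerm (-q ^ a) (q ^ m) n = q ^ (m * (n * (n - 1) / 2) + a * n) := by
  have h := thetaTerm_mul (q ^ a) (-1) (q ^ m) n
  rw [mul_neg_one, thetaTerm_pow hq0, mul_right_comm, ← mul_zpow, neg_one_mul, neg_neg, one_zpow,
    one_mul] at h
  exact h

lemma thetaTerm_pow_neg (hq0 : q ≠ 0) (a m : ℕ) (n : ℤ) :
    thetaTerm (q ^ a) (-q ^ m) n =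
      (-1 : ℂ) ^ (n + n * (n - 1) / 2) * q ^ (m * (n * (n - 1) / 2) + a * n) := by
  rw [thetaTerm, zpow_add₀ hq0, zpow_mul, zpow_mul, zpow_natCast, zpow_natCast,
    neg_eq_neg_one_mul (q ^ m), mul_zpow, zpow_add₀ (by norm_num)]
  ring

lemma theta_mul_theta {x y a b : ℂ} (hx : x ≠ 0) (hy : y ≠ 0) (ha0 : a ≠ 0) (hb0 : b ≠ 0)
    (ha : ‖a‖ < 1) (hb : ‖b‖ < 1) :
    HasSum (fun p : ℤ × ℤ => thetaTerm x a p.1 * thetaTerm y b p.2) (theta x a * theta y b) := by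
  have h1 := summable_norm_thetaTerm hx ha0 ha
  have h2 := summable_norm_thetaTerm hy hb0 hb
  rw [theta_eq_tsum, theta_eq_tsum, tsum_mul_tsum_of_summable_norm h1 h2]
  exact (summable_mul_of_summable_norm h1 h2).hasSum

lemma summable_binaryTheta (hq0 : q ≠ 0) (hq : ‖q‖ < 1) : Summable fun p : ℤ × ℤ =>
    q ^ (4 * p.1 ^ 2 + 2 * p.1 * p.2 + 4 * p.2 ^ 2 - 3 * p.1 + p.2) := by
  have hQ0 : q ^ 6 ≠ 0 := pow_ne_zero _ hq0
  have hQ : ‖q ^ 6‖ < 1 := norm_pow_lt_one hq (by norm_num)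
  have h := ((summable_norm_thetaTerm hq0 (pow_ne_zero 2 hq0)
    (norm_pow_lt_one hq two_ne_zero)).mul_norm ((summable_norm_thetaTerm one_ne_zero hQ0 hQ).mul_norm
        (summable_norm_thetaTerm (pow_ne_zero 4 hq0) hQ0 hQ))).of_norm
  have hinj : Function.Injective fun p : ℤ × ℤ => (-(p.1 + p.2), p.1, p.2) :=
    fun a b h => (Prod.mk.inj h).2
  exact (h.comp_injective hinj).congr fun p => thetaTerm_triple hq0 p.1 p.2

/-- The quadratic part equals `(5/2)(m+n)^2 + (3/2)(m-n)^2`. Since `m + n` and `m - n` have equal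
parity, the sum splits by that parity: `(m, n) = (u - w, u + w)` in the even case and `(u - w + 1, u
+ w)` in the odd case. -/
lemma binaryTheta_eq (hq0 : q ≠ 0) (hq : ‖q‖ < 1) :
    binaryTheta q = theta (-q ^ 8) (q ^ 20) * theta (-q ^ 10) (q ^ 12) +
      q * (theta (-q ^ 18) (q ^ 20) * theta (-q ^ 4) (q ^ 12)) := by
  have hp : ∀ n : ℕ, q ^ n ≠ 0 := fun n => pow_ne_zero n hq0
  have hn : ∀ n : ℕ, -q ^ n ≠ 0 := fun n => neg_ne_zero.2 (hp n)
  have hl : ∀ {n : ℕ}, n ≠ 0 → ‖q ^ n‖ < 1 := fun h => norm_pow_lt_one hq h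
  set F : ℤ × ℤ → ℂ := fun p => q ^ (4 * p.1 ^ 2 + 2 * p.1 * p.2 + 4 * p.2 ^ 2 - 3 * p.1 + p.2)
    with hF
  have hs : Summable fun p : ℤ × ℤ => F (1 * p.1 + 0 * p.2 + 0, 1 * p.1 + 1 * p.2 + 0) :=
    (summable_binaryTheta hq0 hq).comp_injective
      (i := fun p : ℤ × ℤ => (1 * p.1 + 0 * p.2 + 0, 1 * p.1 + 1 * p.2 + 0))
      fun a b h => by simp only [Prod.mk.injEq] at h; ext <;> omega
  rw [show binaryTheta q = ∑' p, F p from rfl, ← tsum_affine F 1 0 1 1 0 0 (by norm_num),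
    tsum_snd_mod 2 hs, Fin.sum_univ_two,
    ← (theta_mul_theta (hn 8) (hn 10) (hp 20) (hp 12) (hl (by norm_num)) (hl (by norm_num))).tsum_eq,
    ← (theta_mul_theta (hn 18) (hn 4) (hp 20) (hp 12) (hl (by norm_num)) (hl (by norm_num))).tsum_eq,
    ← tsum_mul_left,
    ← tsum_affine (fun p : ℤ × ℤ => F (1 * p.1 + 0 * (p.2 * (2 : ℕ) + (((0 : Fin 2) : ℕ) : ℤ)) + 0,
      1 * p.1 + 1 * (p.2 * (2 : ℕ) + (((0 : Fin 2) : ℕ) : ℤ)) + 0)) 1 (-1) 0 1 0 0 (by norm_num),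
    ← tsum_affine (fun p : ℤ × ℤ => F (1 * p.1 + 0 * (p.2 * (2 : ℕ) + (((1 : Fin 2) : ℕ) : ℤ)) + 0,
      1 * p.1 + 1 * (p.2 * (2 : ℕ) + (((1 : Fin 2) : ℕ) : ℤ)) + 0)) 1 (-1) 0 1 1 (-1)
      (by norm_num)]
  congr 1
  · refine tsum_congr fun p => ?_
    obtain ⟨u, w⟩ := p
    rw [thetaTerm_neg_pow hq0, thetaTerm_neg_pow hq0, ← zpow_add₀ hq0]
    simp only [hF]
    congr 1
    have h1 := two_mul_triangle u
    have h2 := two_mul_triangle w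
    push_cast
    simp only [Fin.val_zero]
    push_cast
    linarith
  · refine tsum_congr fun p => ?_
    obtain ⟨u, w⟩ := p
    rw [thetaTerm_neg_pow hq0, thetaTerm_neg_pow hq0, ← zpow_add₀ hq0, ← zpow_one_add₀ hq0]
    simp only [hF]
    congr 1
    have h1 := two_mul_triangle u
    have h2 := two_mul_triangle w
    push_cast
    simp only [Fin.val_one]
    push_cast
    linarith

end Lattice

/-! ### Dissection of `θ(-q^3; q^4) θ(q^3; q^15)` -/

section LatticeIdentity

/-- The shears by `p.2` and `-5 * p.2` are chosen so that each of the eight classes is a full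
lattice in convenient coordinates: four will match `evenTerm`, two `oddTerm`, and two cancel. -/
lemma tsum_split_eight {F : ℤ × ℤ → ℂ} (hF : Summable F) :
    ∑' p, F p =
      ((∑' p : ℤ × ℤ, F (4 * p.1 + p.2, 2 * p.2)) + (∑' p : ℤ × ℤ, F (4 * p.1 + p.2 + 1, 2 * p.2)) +
        (∑' p : ℤ × ℤ, F (4 * p.1 + p.2 + 2, 2 * p.2)) +
        ∑' p : ℤ × ℤ, F (4 * p.1 + p.2 + 3, 2 * p.2)) +
      ((∑' p : ℤ × ℤ, F (4 * p.1 - 5 * p.2, 2 * p.2 + 1)) +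
        (∑' p : ℤ × ℤ, F (4 * p.1 - 5 * p.2 + 1, 2 * p.2 + 1)) +
        (∑' p : ℤ × ℤ, F (4 * p.1 - 5 * p.2 + 2, 2 * p.2 + 1)) +
        ∑' p : ℤ × ℤ, F (4 * p.1 - 5 * p.2 + 3, 2 * p.2 + 1)) := by
  have s0 : Summable fun p : ℤ × ℤ => F (p.1 + p.2, 2 * p.2) :=
    hF.comp_injective (i := fun p : ℤ × ℤ => (p.1 + p.2, 2 * p.2))
      fun a b h => by simp only [Prod.mk.injEq] at h; ext <;> omega
  have s1 : Summable fun p : ℤ × ℤ => F (p.1 - 5 * p.2, 2 * p.2 + 1) :=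
    hF.comp_injective (i := fun p : ℤ × ℤ => (p.1 - 5 * p.2, 2 * p.2 + 1))
      fun a b h => by simp only [Prod.mk.injEq] at h; ext <;> omega
  have h0 := tsum_affine (fun p => F (p.1, 2 * p.2)) 1 1 0 1 0 0 (by norm_num)
  have h1 := tsum_affine (fun p => F (p.1, 2 * p.2 + 1)) 1 (-5) 0 1 0 0 (by norm_num)
  have m0 := tsum_fst_mod 4 s0
  have m1 := tsum_fst_mod 4 s1
  rw [tsum_snd_mod 2 hF, Fin.sum_univ_two]
  have e0 : ∑' p : ℤ × ℤ, F (p.1, p.2 * (2 : ℕ) + (((0 : Fin 2) : ℕ) : ℤ)) =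
      ∑' p : ℤ × ℤ, F (p.1 + p.2, 2 * p.2) := by
    refine Eq.trans (tsum_congr fun p => ?_) (h0.symm.trans (tsum_congr fun p => ?_)) <;>
    · congr 2 <;> simp <;> ring
  have e1 : ∑' p : ℤ × ℤ, F (p.1, p.2 * (2 : ℕ) + (((1 : Fin 2) : ℕ) : ℤ)) =
      ∑' p : ℤ × ℤ, F (p.1 - 5 * p.2, 2 * p.2 + 1) := by
    refine Eq.trans (tsum_congr fun p => ?_) (h1.symm.trans (tsum_congr fun p => ?_)) <;>
    · congr 2 <;> simp <;> ring
  rw [e0, e1, m0, m1, Fin.sum_univ_four, Fin.sum_univ_four]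
  refine congrArg₂ _ (congrArg₂ _ (congrArg₂ _ (congrArg₂ _ ?_ ?_) ?_) ?_)
    (congrArg₂ _ (congrArg₂ _ (congrArg₂ _ ?_ ?_) ?_) ?_) <;>
  · refine tsum_congr fun p => ?_
    congr 2 <;> simp <;> ring

lemma tsum_split_four {F : ℤ × ℤ → ℂ} (hF : Summable F) :
    ∑' p, F p =
      ((∑' p : ℤ × ℤ, F (2 * (p.2 + 2 * p.1), p.2)) +
        ∑' p : ℤ × ℤ, F (2 * (p.2 + 2 * p.1 + 1), p.2)) +
      ((∑' p : ℤ × ℤ, F (2 * (p.2 + 2 * p.1) + 1, p.2)) +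
        ∑' p : ℤ × ℤ, F (2 * (p.2 + 2 * p.1 + 1) + 1, p.2)) := by
  have s : ∀ b : ℤ, Summable fun p : ℤ × ℤ => F (2 * (p.1 + p.2) + b, p.2) := fun b =>
    hF.comp_injective (i := fun p : ℤ × ℤ => (2 * (p.1 + p.2) + b, p.2))
      fun a b h => by simp only [Prod.mk.injEq] at h; ext <;> omega
  have h : ∀ b : ℤ, _ := fun b =>
    tsum_affine (fun p => F (2 * p.1 + b, p.2)) 1 1 0 1 0 0 (by norm_num)
  have m : ∀ b : ℤ, _ := fun b => tsum_fst_mod 2 (s b)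
  have e : ∀ b : ℤ, ∑' p : ℤ × ℤ, F (p.1 * (2 : ℕ) + b, p.2) =
      (∑' p : ℤ × ℤ, F (2 * (p.2 + 2 * p.1) + b, p.2)) +
        ∑' p : ℤ × ℤ, F (2 * (p.2 + 2 * p.1 + 1) + b, p.2) := fun b => by
    have e' : ∑' p : ℤ × ℤ, F (p.1 * (2 : ℕ) + b, p.2) =
        ∑' p : ℤ × ℤ, F (2 * (p.1 + p.2) + b, p.2) := by
      refine Eq.trans (tsum_congr fun p => ?_) ((h b).symm.trans (tsum_congr fun p => ?_)) <;>
      · congr 2 <;> simp <;> ring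
    rw [e', m, Fin.sum_univ_two]
    congr 1 <;> refine tsum_congr fun p => ?_ <;> congr 2 <;> simp <;> ring
  rw [tsum_fst_mod 2 hF, Fin.sum_univ_two, e, e]
  simp

lemma tsum_split_two {F : ℤ × ℤ → ℂ} (hF : Summable F) :
    ∑' p, F p = (∑' p : ℤ × ℤ, F (p.2, p.2 + 2 * p.1)) +
      ∑' p : ℤ × ℤ, F (p.2, p.2 + 2 * p.1 + 1) := by
  have s : Summable fun p : ℤ × ℤ => F (p.2, p.1 + p.2) :=
    hF.comp_injective (i := fun p : ℤ × ℤ => (p.2, p.1 + p.2))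
      fun a b h => by simp only [Prod.mk.injEq] at h; ext <;> omega
  have h := tsum_affine F 0 1 1 1 0 0 (by norm_num)
  have e : ∑' p, F p = ∑' p : ℤ × ℤ, F (p.2, p.1 + p.2) := by
    refine h.symm.trans (tsum_congr fun p => ?_)
    congr 2 <;> simp
  rw [e, tsum_fst_mod 2 s, Fin.sum_univ_two]
  congr 1 <;> refine tsum_congr fun p => ?_ <;> congr 2 <;> simp <;> ring

variable {q : ℂ}

lemma sign_mul_zpow_congr {e e' E E' : ℤ} (he : Even (e - e')) (hE : E = E') :
    (-1 : ℂ) ^ e * q ^ E = (-1 : ℂ) ^ e' * q ^ E' := by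
  rw [hE, show e = (e - e') + e' by ring, zpow_add₀ (by norm_num), he.neg_one_zpow, one_mul]

/-- The summand of `θ(-q^3; q^4) θ(q^3; q^15)`. -/
noncomputable def leftTerm (q : ℂ) (p : ℤ × ℤ) : ℂ :=
  thetaTerm (-q ^ 3) (q ^ 4) p.1 * thetaTerm (q ^ 3) (q ^ 15) p.2

/-- The summand of `θ(q^4; -q^10) θ(q^18; q^24)`. -/
noncomputable def evenTerm (q : ℂ) (p : ℤ × ℤ) : ℂ :=
  thetaTerm (q ^ 4) (-q ^ 10) p.1 * thetaTerm (q ^ 18) (q ^ 24) p.2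

/-- The summand of `θ(q^12; q^24) θ(q^8; q^40)`. -/
noncomputable def oddTerm (q : ℂ) (p : ℤ × ℤ) : ℂ :=
  thetaTerm (q ^ 12) (q ^ 24) p.1 * thetaTerm (q ^ 8) (q ^ 40) p.2

lemma leftTerm_eq (hq0 : q ≠ 0) (k n : ℤ) : leftTerm q (k, n) =
    (-1 : ℂ) ^ n * q ^ (4 * (k * (k - 1) / 2) + 3 * k + (15 * (n * (n - 1) / 2) + 3 * n)) := by
  rw [leftTerm, thetaTerm_neg_pow hq0, thetaTerm_pow hq0, zpow_add₀ hq0 (_ + _)]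
  push_cast
  ring

lemma evenTerm_eq (hq0 : q ≠ 0) (m l : ℤ) : evenTerm q (m, l) =
    (-1 : ℂ) ^ (m + m * (m - 1) / 2 + l) *
      q ^ (10 * (m * (m - 1) / 2) + 4 * m + (24 * (l * (l - 1) / 2) + 18 * l)) := by
  rw [evenTerm, thetaTerm_pow_neg hq0, thetaTerm_pow hq0, zpow_add₀ hq0 (_ + _),
    zpow_add₀ (by norm_num) (_ + _) l]
  push_cast
  ring

lemma oddTerm_eq (hq0 : q ≠ 0) (n l : ℤ) : q * oddTerm q (n, l) =
    (-1 : ℂ) ^ (n + l) *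
      q ^ (1 + (24 * (n * (n - 1) / 2) + 12 * n + (40 * (l * (l - 1) / 2) + 8 * l))) := by
  rw [oddTerm, thetaTerm_pow hq0, thetaTerm_pow hq0, zpow_one_add₀ hq0, zpow_add₀ hq0 (_ + _),
    zpow_add₀ (by norm_num : (-1 : ℂ) ≠ 0)]
  push_cast
  ring

/-- With `X = 4k + 1` and `Y = 10n - 3` the exponent `E` of `leftTerm` satisfies `40 E + 32 = 5X^2 +
3Y^2`. This and the following five matchings rest on `5(a+3b)^2 + 3(a-5b)^2 = 8(a^2 + 15b^2)`, up to
the signs of `b` and `X`. Here `a = (10m - 1)/2`, `b = (4l + 1)/2` for `evenTerm q (m, l)`, and `a =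
10l - 3`, `b = 2n` for `oddTerm q (n, l)`. -/
lemma leftTerm_eq_evenTerm_one (hq0 : q ≠ 0) (i l : ℤ) :
    leftTerm q (4 * l + 5 * i, 2 * i) = evenTerm q (2 * (l + 2 * i), l) := by
  rw [leftTerm_eq hq0, evenTerm_eq hq0, triangle_two_mul, triangle_two_mul]
  have h1 := two_mul_triangle (4 * l + 5 * i)
  have h2 := two_mul_triangle l
  refine sign_mul_zpow_congr ⟨-((l + 2 * i) ^ 2 + l), by ring⟩ ?_
  linarith

lemma leftTerm_eq_evenTerm_two (hq0 : q ≠ 0) (i l : ℤ) :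
    leftTerm q (5 * i + l + 3, 2 * (l + i + 1)) = evenTerm q (2 * (l + 2 * i + 1) + 1, l) := by
  rw [leftTerm_eq hq0, evenTerm_eq hq0, triangle_two_mul, triangle_two_mul_add_one]
  have h1 := two_mul_triangle (5 * i + l + 3)
  have h2 := two_mul_triangle l
  refine sign_mul_zpow_congr ⟨-((l + 2 * i + 1) ^ 2 + l + 2 * i + 1), by ring⟩ ?_
  linarith

lemma leftTerm_eq_evenTerm_three (hq0 : q ≠ 0) (i l : ℤ) :
    leftTerm q (-5 * i - 4 * l - 3, 2 * i + 1) = evenTerm q (2 * (l + 2 * i + 1), l) := by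
  rw [leftTerm_eq hq0, evenTerm_eq hq0, triangle_two_mul, triangle_two_mul_add_one]
  have h1 := two_mul_triangle (-5 * i - 4 * l - 3)
  have h2 := two_mul_triangle l
  refine sign_mul_zpow_congr ⟨-((l + 2 * i + 1) ^ 2 + l), by ring⟩ ?_
  linarith

lemma leftTerm_eq_evenTerm_four (hq0 : q ≠ 0) (i l : ℤ) :
    leftTerm q (-l - 5 * i - 1, 2 * (l + i) + 1) = evenTerm q (2 * (l + 2 * i) + 1, l) := by
  rw [leftTerm_eq hq0, evenTerm_eq hq0, triangle_two_mul_add_one, triangle_two_mul_add_one]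
  have h1 := two_mul_triangle (-l - 5 * i - 1)
  have h2 := two_mul_triangle l
  refine sign_mul_zpow_congr ⟨-((l + 2 * i) ^ 2 + l + 2 * i), by ring⟩ ?_
  linarith

lemma leftTerm_eq_oddTerm_one (hq0 : q ≠ 0) (i n : ℤ) :
    leftTerm q (4 * n + 5 * i - 1, 2 * i) = q * oddTerm q (n, n + 2 * i) := by
  rw [leftTerm_eq hq0, oddTerm_eq hq0, triangle_two_mul]
  have h1 := two_mul_triangle (4 * n + 5 * i - 1)
  have h2 := two_mul_triangle n
  have h3 := two_mul_triangle (n + 2 * i)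
  refine sign_mul_zpow_congr ⟨-n, by ring⟩ ?_
  linarith

lemma leftTerm_eq_oddTerm_two (hq0 : q ≠ 0) (i n : ℤ) :
    leftTerm q (-n - 5 * i - 2, 2 * (i + n) + 1) = q * oddTerm q (n, n + 2 * i + 1) := by
  rw [leftTerm_eq hq0, oddTerm_eq hq0, triangle_two_mul_add_one]
  have h1 := two_mul_triangle (-n - 5 * i - 2)
  have h2 := two_mul_triangle n
  have h3 := two_mul_triangle (n + 2 * i + 1)
  refine sign_mul_zpow_congr ⟨0, by ring⟩ ?_
  linarith

/-- The isometry `(X, Y) ↦ ((X - 3Y)/4, (5X + Y)/4)` of `5X^2 + 3Y^2`, followed by `-1`, carries one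
class to the other and changes the parity of `n`, hence the sign. -/
lemma leftTerm_cancel (hq0 : q ≠ 0) (t a : ℤ) :
    leftTerm q (5 * a - t + 1, 2 * (a - t)) = -leftTerm q (4 * t - 5 * a, 2 * a + 1) := by
  have h1 := two_mul_triangle (5 * a - t + 1)
  have h2 := two_mul_triangle (4 * t - 5 * a)
  have h : (-1 : ℂ) ^ (2 * (a - t)) = -(-1 : ℂ) ^ (2 * a + 1) := by
    rw [zpow_mul, zpow_add₀ (by norm_num), zpow_mul]; norm_num
  rw [leftTerm_eq hq0, leftTerm_eq hq0, triangle_two_mul, triangle_two_mul_add_one, h, neg_mul]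
  congr 3
  linarith

lemma theta_mul_theta_split (hq0 : q ≠ 0) (hq : ‖q‖ < 1) :
    theta (-q ^ 3) (q ^ 4) * theta (q ^ 3) (q ^ 15) =
      theta (q ^ 4) (-q ^ 10) * theta (q ^ 18) (q ^ 24) +
        q * (theta (q ^ 12) (q ^ 24) * theta (q ^ 8) (q ^ 40)) := by
  have hp : ∀ n : ℕ, q ^ n ≠ 0 := fun n => pow_ne_zero n hq0
  have hn : ∀ n : ℕ, -q ^ n ≠ 0 := fun n => neg_ne_zero.2 (hp n)
  have hl : ∀ {n : ℕ}, n ≠ 0 → ‖q ^ n‖ < 1 := fun h => norm_pow_lt_one hq h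
  have hL : HasSum (leftTerm q) _ := theta_mul_theta (hn 3) (hp 3) (hp 4) (hp 15)
    (hl (by norm_num)) (hl (by norm_num))
  have hE : HasSum (evenTerm q) _ := theta_mul_theta (hp 4) (hp 18) (hn 10) (hp 24)
    (by rw [norm_neg]; exact hl (by norm_num)) (hl (by norm_num))
  have hO : HasSum (oddTerm q) _ := theta_mul_theta (hp 12) (hp 8) (hp 24) (hp 40)
    (hl (by norm_num)) (hl (by norm_num))
  rw [← hL.tsum_eq, ← hE.tsum_eq, ← hO.tsum_eq, tsum_split_eight hL.summable,
    tsum_split_four hE.summable, tsum_split_two hO.summable, mul_add]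
  have c1 : ∑' p : ℤ × ℤ, leftTerm q (4 * p.1 + p.2, 2 * p.2) =
      ∑' p : ℤ × ℤ, evenTerm q (2 * (p.2 + 2 * p.1), p.2) := by
    rw [← tsum_affine (fun p => leftTerm q (4 * p.1 + p.2, 2 * p.2)) 1 1 1 0 0 0 (by norm_num)]
    refine tsum_congr fun p => ?_
    rw [← leftTerm_eq_evenTerm_one hq0]
    congr 2 <;> ring
  have c2 : ∑' p : ℤ × ℤ, leftTerm q (4 * p.1 + p.2 + 2, 2 * p.2) =
      ∑' p : ℤ × ℤ, evenTerm q (2 * (p.2 + 2 * p.1 + 1) + 1, p.2) := by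
    rw [← tsum_affine (fun p => leftTerm q (4 * p.1 + p.2 + 2, 2 * p.2)) 1 0 1 1 0 1 (by norm_num)]
    refine tsum_congr fun p => ?_
    rw [← leftTerm_eq_evenTerm_two hq0]
    congr 2 <;> ring
  have c3 : ∑' p : ℤ × ℤ, leftTerm q (4 * p.1 - 5 * p.2 + 1, 2 * p.2 + 1) =
      ∑' p : ℤ × ℤ, evenTerm q (2 * (p.2 + 2 * p.1 + 1), p.2) := by
    rw [← tsum_affine (fun p => leftTerm q (4 * p.1 - 5 * p.2 + 1, 2 * p.2 + 1)) 0 (-1) 1 0 (-1) 0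
      (by norm_num)]
    refine tsum_congr fun p => ?_
    rw [← leftTerm_eq_evenTerm_three hq0]
    congr 2 <;> ring
  have c4 : ∑' p : ℤ × ℤ, leftTerm q (4 * p.1 - 5 * p.2 + 3, 2 * p.2 + 1) =
      ∑' p : ℤ × ℤ, evenTerm q (2 * (p.2 + 2 * p.1) + 1, p.2) := by
    rw [← tsum_affine (fun p => leftTerm q (4 * p.1 - 5 * p.2 + 3, 2 * p.2 + 1)) 0 1 1 1 (-1) 0
      (by norm_num)]
    refine tsum_congr fun p => ?_
    rw [← leftTerm_eq_evenTerm_four hq0]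
    congr 2 <;> ring
  have c5 : ∑' p : ℤ × ℤ, leftTerm q (4 * p.1 + p.2 + 3, 2 * p.2) =
      q * ∑' p : ℤ × ℤ, oddTerm q (p.2, p.2 + 2 * p.1) := by
    rw [← tsum_affine (fun p => leftTerm q (4 * p.1 + p.2 + 3, 2 * p.2)) 1 1 1 0 (-1) 0
      (by norm_num), ← tsum_mul_left]
    refine tsum_congr fun p => ?_
    rw [← leftTerm_eq_oddTerm_one hq0]
    congr 2 <;> ring
  have c6 : ∑' p : ℤ × ℤ, leftTerm q (4 * p.1 - 5 * p.2 + 2, 2 * p.2 + 1) =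
      q * ∑' p : ℤ × ℤ, oddTerm q (p.2, p.2 + 2 * p.1 + 1) := by
    rw [← tsum_affine (fun p => leftTerm q (4 * p.1 - 5 * p.2 + 2, 2 * p.2 + 1)) 0 1 1 1 (-1) 0
      (by norm_num), ← tsum_mul_left]
    refine tsum_congr fun p => ?_
    rw [← leftTerm_eq_oddTerm_two hq0]
    congr 2 <;> ring
  have c7 : ∑' p : ℤ × ℤ, leftTerm q (4 * p.1 + p.2 + 1, 2 * p.2) =
      -∑' p : ℤ × ℤ, leftTerm q (4 * p.1 - 5 * p.2, 2 * p.2 + 1) := by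
    rw [← tsum_affine (fun p => leftTerm q (4 * p.1 + p.2 + 1, 2 * p.2)) 0 1 (-1) 1 0 0
      (by norm_num), ← tsum_neg]
    refine tsum_congr fun p => ?_
    rw [← leftTerm_cancel hq0]
    congr 2 <;> ring
  rw [c1, c2, c3, c4, c5, c6, c7]
  ring

end LatticeIdentity

/-! ### Product identities and the evaluation of the double sum -/

section Products

/-- The product `(q^a; q^m)_∞`. -/
noncomputable def powPoch (q : ℂ) (a m : ℕ) : ℂ := qPoch (q ^ a) (q ^ m)

/-- The product `(-q^a; q^m)_∞`. -/
noncomputable def negPowPoch (q : ℂ) (a m : ℕ) : ℂ := qPoch (-q ^ a) (q ^ m)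

variable {q : ℂ}

lemma powPoch_two (hq : ‖q‖ < 1) (a : ℕ) {m : ℕ} (hm : m ≠ 0) :
    powPoch q a m = powPoch q a (2 * m) * powPoch q (a + m) (2 * m) := by
  rw [powPoch, qPoch_two _ (norm_pow_lt_one hq hm), ← pow_add, ← pow_mul, mul_comm m 2]
  rfl

lemma powPoch_three (hq : ‖q‖ < 1) (a : ℕ) {m : ℕ} (hm : m ≠ 0) :
    powPoch q a m = powPoch q a (3 * m) * powPoch q (a + m) (3 * m) *
      powPoch q (a + 2 * m) (3 * m) := by
  rw [powPoch, qPoch_three _ (norm_pow_lt_one hq hm), ← pow_add, ← pow_mul, ← pow_mul, ← pow_add,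
    mul_comm m 3, mul_comm m 2]
  rfl

lemma powPoch_five (hq : ‖q‖ < 1) (a : ℕ) {m : ℕ} (hm : m ≠ 0) :
    powPoch q a m = powPoch q a (5 * m) * powPoch q (a + m) (5 * m) *
      powPoch q (a + 2 * m) (5 * m) * powPoch q (a + 3 * m) (5 * m) *
      powPoch q (a + 4 * m) (5 * m) := by
  rw [powPoch, qPoch_five _ (norm_pow_lt_one hq hm)]
  simp only [← pow_add, ← pow_mul, mul_comm m]
  rfl

lemma negPowPoch_two (hq : ‖q‖ < 1) (a : ℕ) {m : ℕ} (hm : m ≠ 0) :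
    negPowPoch q a m = negPowPoch q a (2 * m) * negPowPoch q (a + m) (2 * m) := by
  rw [negPowPoch, qPoch_two _ (norm_pow_lt_one hq hm), neg_mul, ← pow_add, ← pow_mul, mul_comm m 2]
  rfl

lemma negPowPoch_three (hq : ‖q‖ < 1) (a : ℕ) {m : ℕ} (hm : m ≠ 0) :
    negPowPoch q a m = negPowPoch q a (3 * m) * negPowPoch q (a + m) (3 * m) *
      negPowPoch q (a + 2 * m) (3 * m) := by
  rw [negPowPoch, qPoch_three _ (norm_pow_lt_one hq hm), neg_mul, neg_mul, ← pow_add, ← pow_mul,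
    ← pow_mul, ← pow_add, mul_comm m 3, mul_comm m 2]
  rfl

lemma negPowPoch_five (hq : ‖q‖ < 1) (a : ℕ) {m : ℕ} (hm : m ≠ 0) :
    negPowPoch q a m = negPowPoch q a (5 * m) * negPowPoch q (a + m) (5 * m) *
      negPowPoch q (a + 2 * m) (5 * m) * negPowPoch q (a + 3 * m) (5 * m) *
      negPowPoch q (a + 4 * m) (5 * m) := by
  rw [negPowPoch, qPoch_five _ (norm_pow_lt_one hq hm)]
  simp only [neg_mul, ← pow_add, ← pow_mul, mul_comm m]
  rfl

lemma powPoch_mul_negPowPoch (hq : ‖q‖ < 1) (a : ℕ) {m : ℕ} (hm : m ≠ 0) :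
    powPoch q a m * negPowPoch q a m = powPoch q (2 * a) (2 * m) := by
  rw [powPoch, negPowPoch, qPoch_mul_neg _ (norm_pow_lt_one hq hm), ← pow_mul, ← pow_mul,
    mul_comm m 2, mul_comm a 2]
  rfl

lemma powPoch_ne_zero (hq : ‖q‖ < 1) {a m : ℕ} (ha : a ≠ 0) (hm : m ≠ 0) : powPoch q a m ≠ 0 :=
  qPoch_ne_zero (norm_pow_lt_one hq ha) (norm_pow_lt_one hq hm)

lemma negPowPoch_ne_zero (hq : ‖q‖ < 1) {a m : ℕ} (ha : a ≠ 0) (hm : m ≠ 0) :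
    negPowPoch q a m ≠ 0 :=
  qPoch_ne_zero (by rw [norm_neg]; exact norm_pow_lt_one hq ha) (norm_pow_lt_one hq hm)

lemma theta_pow_eq (hq0 : q ≠ 0) (hq : ‖q‖ < 1) (a b : ℕ) (h : a + b ≠ 0) :
    theta (q ^ a) (q ^ (a + b)) =
      powPoch q (a + b) (a + b) * powPoch q a (a + b) * powPoch q b (a + b) := by
  rw [theta_eq_qPoch (pow_ne_zero _ hq0) (pow_ne_zero _ hq0) (norm_pow_lt_one hq h),
    show q ^ (a + b) / q ^ a = q ^ b by rw [pow_add]; field_simp]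
  rfl

lemma theta_neg_pow_eq (hq0 : q ≠ 0) (hq : ‖q‖ < 1) (a b : ℕ) (h : a + b ≠ 0) :
    theta (-q ^ a) (q ^ (a + b)) =
      powPoch q (a + b) (a + b) * negPowPoch q a (a + b) * negPowPoch q b (a + b) := by
  rw [theta_eq_qPoch (neg_ne_zero.2 (pow_ne_zero _ hq0)) (pow_ne_zero _ hq0) (norm_pow_lt_one hq h),
    show q ^ (a + b) / -q ^ a = -q ^ b by rw [pow_add]; field_simp]
  rfl

lemma theta_pow_neg_eq (hq0 : q ≠ 0) (hq : ‖q‖ < 1) :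
    theta (q ^ 2) (-q ^ 5) = negPowPoch q 5 10 * powPoch q 10 10 *
      (powPoch q 2 10 * negPowPoch q 7 10) * (negPowPoch q 3 10 * powPoch q 8 10) := by
  have h5 : ‖-q ^ 5‖ < 1 := by rw [norm_neg]; exact norm_pow_lt_one hq (by norm_num)
  rw [theta_eq_qPoch (pow_ne_zero _ hq0) (neg_ne_zero.2 (pow_ne_zero _ hq0)) h5,
    show -q ^ 5 / q ^ 2 = -q ^ 3 by field_simp, qPoch_two (-q ^ 5) h5, qPoch_two (q ^ 2) h5,
    qPoch_two (-q ^ 3) h5]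
  simp only [powPoch, negPowPoch]
  ring_nf

/-- Multiplication by `(-q^3; q^6)` completes the base `q^6` factors to `(-q; q^2)`. Dissected
modulo 5, this supplies the partners of `(q; q^10)` and `(q^9; q^10)` in `(x; p)(-x; p) = (x^2;
p^2)`. -/
lemma theta_product_even (hq0 : q ≠ 0) (hq : ‖q‖ < 1) :
    theta (-q ^ 4) (q ^ 10) * theta (-q ^ 5) (q ^ 6) * (powPoch q 1 5 * powPoch q 4 5) =
      theta (q ^ 2) (-q ^ 5) * theta (q ^ 9) (q ^ 12) := by
  have t1 : theta (-q ^ 4) (q ^ 10) = powPoch q 10 10 * negPowPoch q 4 10 * negPowPoch q 6 10 :=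
    theta_neg_pow_eq hq0 hq 4 6 (by norm_num)
  have t2 : theta (-q ^ 5) (q ^ 6) = powPoch q 6 6 * negPowPoch q 5 6 * negPowPoch q 1 6 :=
    theta_neg_pow_eq hq0 hq 5 1 (by norm_num)
  have t3 : theta (q ^ 9) (q ^ 12) = powPoch q 12 12 * powPoch q 9 12 * powPoch q 3 12 :=
    theta_pow_eq hq0 hq 9 3 (by norm_num)
  have a1 : powPoch q 1 5 = powPoch q 1 10 * powPoch q 6 10 := powPoch_two hq 1 (by norm_num)
  have a2 : powPoch q 4 5 = powPoch q 4 10 * powPoch q 9 10 := powPoch_two hq 4 (by norm_num)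
  have a3 : negPowPoch q 1 2 = negPowPoch q 1 6 * negPowPoch q 3 6 * negPowPoch q 5 6 :=
    negPowPoch_three hq 1 (by norm_num)
  have a4 : negPowPoch q 1 2 = negPowPoch q 1 10 * negPowPoch q 3 10 * negPowPoch q 5 10 *
    negPowPoch q 7 10 * negPowPoch q 9 10 := negPowPoch_five hq 1 (by norm_num)
  have a5 : powPoch q 6 6 = powPoch q 6 12 * powPoch q 12 12 := powPoch_two hq 6 (by norm_num)
  have a6 : powPoch q 3 6 * negPowPoch q 3 6 = powPoch q 6 12 :=
    powPoch_mul_negPowPoch hq 3 (by norm_num)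
  have a7 : powPoch q 3 6 = powPoch q 3 12 * powPoch q 9 12 := powPoch_two hq 3 (by norm_num)
  have b1 : powPoch q 4 10 * negPowPoch q 4 10 = powPoch q 8 20 :=
    powPoch_mul_negPowPoch hq 4 (by norm_num)
  have b2 : powPoch q 6 10 * negPowPoch q 6 10 = powPoch q 12 20 :=
    powPoch_mul_negPowPoch hq 6 (by norm_num)
  have b3 : powPoch q 1 10 * negPowPoch q 1 10 = powPoch q 2 20 :=
    powPoch_mul_negPowPoch hq 1 (by norm_num)
  have b4 : powPoch q 9 10 * negPowPoch q 9 10 = powPoch q 18 20 :=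
    powPoch_mul_negPowPoch hq 9 (by norm_num)
  have b5 : powPoch q 2 10 = powPoch q 2 20 * powPoch q 12 20 := powPoch_two hq 2 (by norm_num)
  have b6 : powPoch q 8 10 = powPoch q 8 20 * powPoch q 18 20 := powPoch_two hq 8 (by norm_num)
  have hne : negPowPoch q 3 6 ≠ 0 := negPowPoch_ne_zero hq (by norm_num) (by norm_num)
  refine mul_left_cancel₀ hne ?_
  calc negPowPoch q 3 6 * (theta (-q ^ 4) (q ^ 10) * theta (-q ^ 5) (q ^ 6) *
        (powPoch q 1 5 * powPoch q 4 5))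
      = powPoch q 10 10 * powPoch q 6 6 * (negPowPoch q 1 6 * negPowPoch q 3 6 * negPowPoch q 5 6) *
        (negPowPoch q 4 10 * negPowPoch q 6 10 * powPoch q 1 10 * powPoch q 6 10 *
          powPoch q 4 10 * powPoch q 9 10) := by rw [t1, t2, a1, a2]; ring
    _ = powPoch q 10 10 * powPoch q 6 6 * (negPowPoch q 3 10 * negPowPoch q 5 10 *
          negPowPoch q 7 10) * ((powPoch q 1 10 * negPowPoch q 1 10) *
          (powPoch q 6 10 * negPowPoch q 6 10) * ((powPoch q 4 10 * negPowPoch q 4 10) *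
          (powPoch q 9 10 * negPowPoch q 9 10))) := by rw [← a3, a4]; ring
    _ = powPoch q 10 10 * powPoch q 12 12 * (powPoch q 3 6 * negPowPoch q 3 6) *
          (negPowPoch q 3 10 * negPowPoch q 5 10 * negPowPoch q 7 10) *
          (powPoch q 2 10 * powPoch q 8 10) := by rw [b1, b2, b3, b4, b5, b6, a5, a6]; ring
    _ = _ := by rw [theta_pow_neg_eq hq0 hq, t3, a7]; ring

/-- The base `q^10` factors assemble `(q^2; q^4)`. Multiplication by `(q^4; q^4)` completes it to
`(q^2; q^2)`, whose dissection modulo 3 pairs with the base `q^6` factors. -/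
lemma theta_product_odd (hq0 : q ≠ 0) (hq : ‖q‖ < 1) :
    theta (-q ^ 9) (q ^ 10) * theta (-q ^ 2) (q ^ 6) * (powPoch q 1 5 * powPoch q 4 5) =
      theta (q ^ 6) (q ^ 12) * theta (q ^ 4) (q ^ 20) := by
  have t1 : theta (-q ^ 9) (q ^ 10) = powPoch q 10 10 * negPowPoch q 9 10 * negPowPoch q 1 10 :=
    theta_neg_pow_eq hq0 hq 9 1 (by norm_num)
  have t2 : theta (-q ^ 2) (q ^ 6) = powPoch q 6 6 * negPowPoch q 2 6 * negPowPoch q 4 6 :=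
    theta_neg_pow_eq hq0 hq 2 4 (by norm_num)
  have t3 : theta (q ^ 6) (q ^ 12) = powPoch q 12 12 * powPoch q 6 12 * powPoch q 6 12 :=
    theta_pow_eq hq0 hq 6 6 (by norm_num)
  have t4 : theta (q ^ 4) (q ^ 20) = powPoch q 20 20 * powPoch q 4 20 * powPoch q 16 20 :=
    theta_pow_eq hq0 hq 4 16 (by norm_num)
  have a1 : powPoch q 1 5 = powPoch q 1 10 * powPoch q 6 10 := powPoch_two hq 1 (by norm_num)
  have a2 : powPoch q 4 5 = powPoch q 4 10 * powPoch q 9 10 := powPoch_two hq 4 (by norm_num)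
  have a3 : powPoch q 10 10 = powPoch q 10 20 * powPoch q 20 20 := powPoch_two hq 10 (by norm_num)
  have a4 : powPoch q 4 10 = powPoch q 4 20 * powPoch q 14 20 := powPoch_two hq 4 (by norm_num)
  have a5 : powPoch q 6 10 = powPoch q 6 20 * powPoch q 16 20 := powPoch_two hq 6 (by norm_num)
  have a6 : powPoch q 2 4 = powPoch q 2 20 * powPoch q 6 20 * powPoch q 10 20 * powPoch q 14 20 *
    powPoch q 18 20 := powPoch_five hq 2 (by norm_num)
  have a7 : powPoch q 2 2 = powPoch q 2 4 * powPoch q 4 4 := powPoch_two hq 2 (by norm_num)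
  have a8 : powPoch q 2 2 = powPoch q 2 6 * powPoch q 4 6 * powPoch q 6 6 :=
    powPoch_three hq 2 (by norm_num)
  have a9 : powPoch q 4 4 = powPoch q 4 12 * powPoch q 8 12 * powPoch q 12 12 :=
    powPoch_three hq 4 (by norm_num)
  have b1 : powPoch q 2 6 * negPowPoch q 2 6 = powPoch q 4 12 :=
    powPoch_mul_negPowPoch hq 2 (by norm_num)
  have b2 : powPoch q 4 6 * negPowPoch q 4 6 = powPoch q 8 12 :=
    powPoch_mul_negPowPoch hq 4 (by norm_num)
  have b3 : powPoch q 1 10 * negPowPoch q 1 10 = powPoch q 2 20 :=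
    powPoch_mul_negPowPoch hq 1 (by norm_num)
  have b4 : powPoch q 9 10 * negPowPoch q 9 10 = powPoch q 18 20 :=
    powPoch_mul_negPowPoch hq 9 (by norm_num)
  have b5 : powPoch q 6 6 = powPoch q 6 12 * powPoch q 12 12 := powPoch_two hq 6 (by norm_num)
  have hne : powPoch q 4 4 ≠ 0 := powPoch_ne_zero hq (by norm_num) (by norm_num)
  refine mul_left_cancel₀ hne ?_
  calc powPoch q 4 4 * (theta (-q ^ 9) (q ^ 10) * theta (-q ^ 2) (q ^ 6) *
        (powPoch q 1 5 * powPoch q 4 5))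
      = powPoch q 20 20 * powPoch q 4 20 * powPoch q 16 20 * (((powPoch q 1 10 *
          negPowPoch q 1 10) * powPoch q 6 20 * powPoch q 10 20 * powPoch q 14 20 *
          (powPoch q 9 10 * negPowPoch q 9 10)) * powPoch q 4 4) *
          (powPoch q 6 6 * negPowPoch q 2 6 * negPowPoch q 4 6) := by
        rw [t1, t2, a1, a2, a3, a4, a5]; ring
    _ = powPoch q 20 20 * powPoch q 4 20 * powPoch q 16 20 * (powPoch q 6 6 * powPoch q 6 6 *
          ((powPoch q 2 6 * negPowPoch q 2 6) * (powPoch q 4 6 * negPowPoch q 4 6))) := by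
        rw [b3, b4, ← a6, ← a7, a8]; ring
    _ = _ := by rw [b1, b2, b5, t3, t4, a9]; ring

lemma qPoch_mul_theta_neg (hq0 : q ≠ 0) (hq : ‖q‖ < 1) :
    powPoch q 1 1 * theta (-q ^ 3) (q ^ 4) = powPoch q 2 2 * powPoch q 2 2 := by
  have t1 : theta (-q ^ 3) (q ^ 4) = powPoch q 4 4 * negPowPoch q 3 4 * negPowPoch q 1 4 :=
    theta_neg_pow_eq hq0 hq 3 1 (by norm_num)
  have a1 : powPoch q 1 1 = powPoch q 1 2 * powPoch q 2 2 := powPoch_two hq 1 (by norm_num)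
  have a2 : negPowPoch q 1 2 = negPowPoch q 1 4 * negPowPoch q 3 4 :=
    negPowPoch_two hq 1 (by norm_num)
  have a3 : powPoch q 1 2 * negPowPoch q 1 2 = powPoch q 2 4 :=
    powPoch_mul_negPowPoch hq 1 (by norm_num)
  have a4 : powPoch q 2 2 = powPoch q 2 4 * powPoch q 4 4 := powPoch_two hq 2 (by norm_num)
  calc powPoch q 1 1 * theta (-q ^ 3) (q ^ 4)
      = powPoch q 2 2 * ((powPoch q 1 2 * (negPowPoch q 1 4 * negPowPoch q 3 4)) *
        powPoch q 4 4) := by rw [t1, a1]; ring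
    _ = _ := by rw [← a2, a3, ← a4]

lemma theta_four_ten_mul (hq0 : q ≠ 0) (hq : ‖q‖ < 1) :
    theta (q ^ 4) (q ^ 10) * (powPoch q 2 10 * powPoch q 8 10) = powPoch q 2 2 := by
  have t1 : theta (q ^ 4) (q ^ 10) = powPoch q 10 10 * powPoch q 4 10 * powPoch q 6 10 :=
    theta_pow_eq hq0 hq 4 6 (by norm_num)
  have a1 : powPoch q 2 2 = powPoch q 2 10 * powPoch q 4 10 * powPoch q 6 10 * powPoch q 8 10 *
    powPoch q 10 10 := powPoch_five hq 2 (by norm_num)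
  rw [t1, a1]; ring

/-- The two preceding product identities, at `q^2` in place of `q`, convert the two terms of
`binaryTheta_eq` into those of `theta_mul_theta_split`. -/
lemma binaryTheta_mul (hq0 : q ≠ 0) (hq : ‖q‖ < 1) :
    binaryTheta q * (powPoch q 2 10 * powPoch q 8 10) =
      theta (-q ^ 3) (q ^ 4) * theta (q ^ 3) (q ^ 15) := by
  have h1 := theta_product_even (pow_ne_zero 2 hq0) (norm_pow_lt_one hq two_ne_zero)
  have h2 := theta_product_odd (pow_ne_zero 2 hq0) (norm_pow_lt_one hq two_ne_zero)
  simp only [powPoch, ← pow_mul] at h1 h2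
  norm_num at h1 h2
  rw [theta_mul_theta_split hq0 hq, binaryTheta_eq hq0 hq, powPoch, powPoch]
  linear_combination h1 + q * h2

/-- The evaluation of the double-sum `f_{6,6,1}(q^6, q^4, q)`. -/
theorem heckeSum_eq (hq0 : q ≠ 0) (hq : ‖q‖ < 1) :
    heckeSum 6 6 1 (q ^ 6) (q ^ 4) q = theta (q ^ 4) (q ^ 10) * theta (q ^ 3) (q ^ 15) := by
  have h1 := qPoch_mul_heckeSum hq0 hq
  have h2 := binaryTheta_mul hq0 hq
  have h3 := theta_four_ten_mul hq0 hq
  have h4 := qPoch_mul_theta_neg hq0 hq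
  have e1 : qPoch (q ^ 2) (q ^ 2) = powPoch q 2 2 := rfl
  have e2 : qPoch q q = powPoch q 1 1 := by rw [powPoch, pow_one]
  rw [e1, e2] at h1
  have n1 : powPoch q 2 2 ≠ 0 := powPoch_ne_zero hq (by norm_num) (by norm_num)
  have n2 : powPoch q 2 10 * powPoch q 8 10 ≠ 0 :=
    mul_ne_zero (powPoch_ne_zero hq (by norm_num) (by norm_num))
      (powPoch_ne_zero hq (by norm_num) (by norm_num))
  refine mul_left_cancel₀ (mul_ne_zero n1 n2) ?_
  linear_combination (powPoch q 2 10 * powPoch q 8 10) * h1 + powPoch q 1 1 * h2 +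
    theta (q ^ 3) (q ^ 15) * h4 - powPoch q 2 2 * theta (q ^ 3) (q ^ 15) * h3

lemma tprod_residues (hq : ‖q‖ < 1) {k a b : ℕ} (hk : k ≠ 0) (ha : 0 < a) (hab : a < b)
    (hb : b < 5) {P : ℕ → Prop} (hP : ∀ n, P n ↔ 1 ≤ n ∧ (n % 5 = 0 ∨ n % 5 = a ∨ n % 5 = b)) :
    ∏' n : {n // P n}, (1 - q ^ (k * (n : ℕ))) =
      powPoch q (k * 5) (k * 5) * powPoch q (k * a) (k * 5) * powPoch q (k * b) (k * 5) := by
  -- The class of `0` is represented by `5`, because the product starts at `n = 1`.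
  let r : Fin 3 → ℕ := ![5, a, b]
  have hr : ∀ x : Fin 3 × ℕ, P (5 * x.2 + r x.1) := fun ⟨c, i⟩ => by
    rw [hP]
    fin_cases c <;> simp [r] <;> omega
  let e : Fin 3 × ℕ ≃ {n // P n} := Equiv.ofBijective (fun x => ⟨5 * x.2 + r x.1, hr x⟩) <| by
    constructor
    · rintro ⟨c, i⟩ ⟨d, j⟩ h
      rw [Subtype.mk.injEq] at h
      fin_cases c <;> fin_cases d <;> simp [r] at h ⊢ <;> omega
    · rintro ⟨n, hn⟩
      obtain ⟨h1, h2 | h2 | h2⟩ := (hP n).1 hn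
      · exact ⟨(0, n / 5 - 1), Subtype.ext (by simp [r]; omega)⟩
      · exact ⟨(1, n / 5), Subtype.ext (by simp [r]; omega)⟩
      · exact ⟨(2, n / 5), Subtype.ext (by simp [r]; omega)⟩
  have hs : Summable fun n : {n // P n} => ‖-q ^ (k * (n : ℕ))‖ := by
    have h1 := summable_geometric_of_lt_one (norm_nonneg _) (norm_pow_lt_one hq hk)
    refine (h1.comp_injective (Subtype.val_injective (p := P))).congr fun n => ?_
    simp [pow_mul]
  have hm : Multipliable fun n : {n // P n} => 1 - q ^ (k * (n : ℕ)) := by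
    simpa [sub_eq_add_neg] using multipliable_one_add_of_summable hs
  have hc : ∀ (c : Fin 3) (i : ℕ), 1 - q ^ (k * (e (c, i) : ℕ)) =
      1 - q ^ (k * r c) * (q ^ (k * 5)) ^ i := fun c i => by
    rw [← pow_mul, ← pow_add, show (e (c, i) : ℕ) = 5 * i + r c from rfl]
    ring_nf
  have hq5 : ‖q ^ (k * 5)‖ < 1 := norm_pow_lt_one hq (by positivity)
  have h2 := (e.multipliable_iff.2 hm).tprod_prod' fun c => by
    simp only [Function.comp_apply, hc]
    exact multipliable_qPoch _ hq5
  have h3 := (e.tprod_eq fun n : {n // P n} => 1 - q ^ (k * (n : ℕ))).symm.trans h2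
  rw [h3, tprod_fintype, Fin.prod_univ_three]
  simp only [Function.comp_apply, hc]
  rfl

lemma theta_four_ten_eq_tprod (hq0 : q ≠ 0) (hq : ‖q‖ < 1) :
    theta (q ^ 4) (q ^ 10) =
      ∏' n : {n : ℕ // 1 ≤ n ∧ n % 5 ≠ 1 ∧ n % 5 ≠ 4}, (1 - q ^ (2 * (n : ℕ))) := by
  rw [tprod_residues hq two_ne_zero (a := 2) (b := 3) (by norm_num) (by norm_num) (by norm_num)
    fun n => by omega]
  exact theta_pow_eq hq0 hq 4 6 (by norm_num)

lemma theta_three_fifteen_eq_tprod (hq0 : q ≠ 0) (hq : ‖q‖ < 1) :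
    theta (q ^ 3) (q ^ 15) =
      ∏' n : {n : ℕ // 1 ≤ n ∧ n % 5 ≠ 2 ∧ n % 5 ≠ 3}, (1 - q ^ (3 * (n : ℕ))) := by
  rw [tprod_residues hq three_ne_zero (a := 1) (b := 4) (by norm_num) (by norm_num) (by norm_num)
    fun n => by omega]
  exact theta_pow_eq hq0 hq 3 12 (by norm_num)

end Products

/-! ### The Kac–Peterson index set and the string function -/

section StringFunction

/-- The odd integer `(-1)^u (2 u + 1)`, which is `1` modulo `4`. -/
def signedOdd (u : ℤ) : ℤ := if u % 2 = 0 then 2 * u + 1 else -(2 * u + 1)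

/-- The point of the Kac-Peterson index set that belongs to the pair `(r, s)`. -/
noncomputable def kpPoint (p : ℤ × ℤ) : ℝ × ℝ :=
  ((signedOdd (p.1 + p.2) : ℝ) / 4, ((1 - 10 * p.2 : ℤ) : ℝ) / 20)

lemma abs_bounds_iff (X Y : ℤ) :
    (-|(X : ℝ) / 4| < (Y : ℝ) / 20 ∧ (Y : ℝ) / 20 ≤ |(X : ℝ) / 4|) ↔
      (-(5 * |X|) < Y ∧ Y ≤ 5 * |X|) := by
  rw [abs_div, ← Int.cast_abs, abs_of_pos (by norm_num : (0 : ℝ) < 4),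
    ← Int.cast_lt (R := ℝ), ← Int.cast_le (R := ℝ)]
  push_cast
  constructor <;> rintro ⟨h1, h2⟩ <;> constructor <;> linarith

/-- The coset point is `(1/4, 1/20)`. The first alternative gives the even values of `s` and the
second the odd ones, so together `x ∈ 1/4 + ℤ` and `y ∈ 1/20 + (1/2)ℤ`. -/
lemma exists_coords_of_mem_kpIndex {p : ℝ × ℝ} (hp : p ∈ kpIndex 1 5 10) :
    ∃ i s : ℤ, p.1 = ((4 * i + 1 : ℤ) : ℝ) / 4 ∧ p.2 = ((1 - 10 * s : ℤ) : ℝ) / 20 := by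
  obtain ⟨-, ⟨i, k, h1, h2⟩ | ⟨i, k, h1, h2⟩⟩ := hp
  · refine ⟨i, -2 * k, ?_, ?_⟩
    · rw [h1]; push_cast; ring
    · rw [h2]; push_cast; ring
  · refine ⟨-i, 1 - 2 * k, ?_, ?_⟩
    · push_cast at h1 ⊢; linarith
    · push_cast at h2 ⊢; linarith

lemma kpPoint_mem {p : ℤ × ℤ} (hp : p ∈ nonnegPairs ∨ p ∈ negPairs) :
    kpPoint p ∈ kpIndex 1 5 10 := by
  obtain ⟨r, s⟩ := p
  simp only [nonnegPairs, negPairs, Set.mem_ofPred_eq] at hp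
  refine ⟨(abs_bounds_iff _ _).2 ?_, ?_⟩
  · simp only [signedOdd]
    split_ifs <;> rcases abs_cases (2 * (r + s) + 1) with h | h <;> (try rw [abs_neg]) <;> omega
  · obtain ⟨i, hi⟩ : ∃ i, signedOdd (r + s) = 4 * i + 1 := by
      refine ⟨(signedOdd (r + s) - 1) / 4, ?_⟩
      simp only [signedOdd]
      split_ifs <;> omega
    rcases Int.even_or_odd' s with ⟨j, rfl | rfl⟩
    · refine Or.inl ⟨i, -j, ?_, ?_⟩ <;> simp only [kpPoint, hi] <;> push_cast <;> ring
    · refine Or.inr ⟨-i, -j, ?_, ?_⟩ <;> simp only [kpPoint, hi] <;> push_cast <;> ring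

/-- `signedOdd` takes the same value at `u` and `-1 - u`, so this alone does not recover `r + s`. On
the two quadrants the sign of `s` fixes that of `r + s` and removes the ambiguity. -/
lemma kpPoint_injective {p p' : ℤ × ℤ} (h : kpPoint p = kpPoint p') :
    signedOdd (p.1 + p.2) = signedOdd (p'.1 + p'.2) ∧ p.2 = p'.2 := by
  simp only [kpPoint, Prod.mk.injEq] at h
  obtain ⟨h1, h2⟩ := h
  have h3 : (signedOdd (p.1 + p.2) : ℝ) = signedOdd (p'.1 + p'.2) := by linarith
  have h4 : ((1 - 10 * p.2 : ℤ) : ℝ) = ((1 - 10 * p'.2 : ℤ) : ℝ) := by linarith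
  rw [Int.cast_inj] at h3 h4
  exact ⟨h3, by omega⟩

/-- The Kac-Peterson index set is parametrized by the index pairs of the double-sum. -/
noncomputable def kpEquiv : nonnegPairs ⊕ negPairs ≃ kpIndex 1 5 10 :=
  Equiv.ofBijective (Sum.elim (fun p => ⟨kpPoint p, kpPoint_mem (Or.inl p.2)⟩)
    fun p => ⟨kpPoint p, kpPoint_mem (Or.inr p.2)⟩) <| by
    constructor
    · rintro (⟨⟨r, s⟩, h1, h2⟩ | ⟨⟨r, s⟩, h1, h2⟩) (⟨⟨r', s'⟩, h3, h4⟩ | ⟨⟨r', s'⟩, h3, h4⟩) h <;>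
      · simp only [Sum.elim_inl, Sum.elim_inr, Subtype.mk.injEq] at h
        obtain ⟨h5, h6⟩ := kpPoint_injective h
        simp only [signedOdd] at h1 h2 h3 h4 h5 h6
        first
        | (exfalso; omega)
        | (have h7 : r = r' := by split_ifs at h5 <;> omega
           subst h6 h7
           rfl)
    · rintro ⟨⟨x, y⟩, hp⟩
      obtain ⟨i, s, h1, h2⟩ := exists_coords_of_mem_kpIndex hp
      simp only at h1 h2
      subst h1 h2
      obtain ⟨h3, h4⟩ := (abs_bounds_iff _ _).1 hp.1
      have habs := abs_cases (4 * i + 1)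
      -- The sign of `s` selects the quadrant, hence which of the two preimages `2i` and `-2i - 1`
      -- of `4i + 1` is `r + s`; the bounds on `y` then give the sign of `r`.
      rcases lt_or_ge i 0 with hi | hi <;> rcases lt_or_ge s 0 with hs | hs
      · refine ⟨Sum.inr ⟨(2 * i - s, s), by simp only [negPairs, Set.mem_ofPred_eq]; omega⟩,
          Subtype.ext ?_⟩
        simp only [Sum.elim_inr, kpPoint, signedOdd, sub_add_cancel]
        rw [if_pos (by omega)]
        push_cast
        ring_nf
      · refine ⟨Sum.inl ⟨(-2 * i - 1 - s, s), by simp only [nonnegPairs, Set.mem_ofPred_eq]; omega⟩,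
          Subtype.ext ?_⟩
        simp only [Sum.elim_inl, kpPoint, signedOdd, sub_add_cancel]
        rw [if_neg (by omega)]
        push_cast
        ring_nf
      · refine ⟨Sum.inr ⟨(-2 * i - 1 - s, s), by simp only [negPairs, Set.mem_ofPred_eq]; omega⟩,
          Subtype.ext ?_⟩
        simp only [Sum.elim_inr, kpPoint, signedOdd, sub_add_cancel]
        rw [if_neg (by omega)]
        push_cast
        ring_nf
      · refine ⟨Sum.inl ⟨(2 * i - s, s), by simp only [nonnegPairs, Set.mem_ofPred_eq]; omega⟩,
          Subtype.ext ?_⟩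
        simp only [Sum.elim_inl, kpPoint, signedOdd, sub_add_cancel]
        rw [if_pos (by omega)]
        push_cast
        ring_nf

variable {q : ℂ} {τ : UpperHalfPlane}

lemma qPow_add_int (hq : q = Complex.exp (2 * Real.pi * Complex.I * (τ : ℂ))) (a : ℝ) (n : ℤ) :
    qPow τ (a + n) = qPow τ a * q ^ n := by
  rw [hq, qPow, qPow, ← Complex.exp_int_mul, ← Complex.exp_add]
  push_cast
  ring_nf

lemma heckeTerm_eq_zpow (hq0 : q ≠ 0) (r s : ℤ) :
    heckeTerm 6 6 1 (q ^ 6) (q ^ 4) q (r, s) = (-1 : ℂ) ^ (r + s) *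
      q ^ (6 * r + 4 * s + (6 * (r * (r - 1) / 2) + 6 * r * s + 1 * (s * (s - 1) / 2))) := by
  rw [heckeTerm, zpow_add₀ hq0 (6 * r + 4 * s), zpow_add₀ hq0 (6 * r), zpow_mul, zpow_mul]
  norm_cast
  ring

/-- The constant is the value at `r = s = 0`, namely `12/16 - 10/400 = 29/40`. -/
lemma qPow_kpPoint (hq : q = Complex.exp (2 * Real.pi * Complex.I * (τ : ℂ))) (r s : ℤ) :
    qPow τ (((10 : ℤ) + 2) * (kpPoint (r, s)).1 ^ 2 - (10 : ℤ) * (kpPoint (r, s)).2 ^ 2) =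
      qPow τ (29 / 40) *
        q ^ (6 * r + 4 * s + (6 * (r * (r - 1) / 2) + 6 * r * s + 1 * (s * (s - 1) / 2))) := by
  rw [← qPow_add_int hq]
  congr 1
  have h1 : (signedOdd (r + s) : ℝ) ^ 2 = (2 * (r + s) + 1) ^ 2 := by
    rw [signedOdd]; split_ifs <;> push_cast <;> ring
  have h2 : (2 : ℝ) * ((r * (r - 1) / 2 : ℤ) : ℝ) = r * (r - 1) := by
    exact_mod_cast two_mul_triangle r
  have h3 : (2 : ℝ) * ((s * (s - 1) / 2 : ℤ) : ℝ) = s * (s - 1) := by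
    exact_mod_cast two_mul_triangle s
  simp only [kpPoint]
  rw [div_pow, h1]
  push_cast at h2 h3 ⊢
  linear_combination -3 * h2 - h3 / 2

lemma kpTerm_inl (hq : q = Complex.exp (2 * Real.pi * Complex.I * (τ : ℂ))) (p : nonnegPairs) :
    kpTerm 10 τ (kpEquiv (Sum.inl p)) =
      qPow τ (29 / 40) * heckeTerm 6 6 1 (q ^ 6) (q ^ 4) q p := by
  obtain ⟨⟨r, s⟩, h1, h2⟩ := p
  simp only at h1 h2
  have hq0 : q ≠ 0 := hq ▸ Complex.exp_ne_zero _
  have e : (kpEquiv (Sum.inl ⟨(r, s), h1, h2⟩) : ℝ × ℝ) = kpPoint (r, s) := rfl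
  have hs : (if 0 ≤ (kpPoint (r, s)).1 then 1 else -1 : ℂ) = (-1 : ℂ) ^ (r + s) := by
    have h : 0 ≤ (kpPoint (r, s)).1 ↔ 0 ≤ signedOdd (r + s) := by
      simp only [kpPoint]
      rw [← Int.cast_nonneg_iff (R := ℝ)]
      constructor <;> intro h <;> linarith
    rcases Int.even_or_odd (r + s) with h3 | h3
    · rw [h3.neg_one_zpow, if_pos (h.2 ?_)]
      rw [signedOdd, if_pos (Int.even_iff.1 h3)]; omega
    · rw [h3.neg_one_zpow, if_neg (h.not.2 ?_)]
      rw [signedOdd, if_neg (by rw [Int.odd_iff.1 h3]; norm_num)]; omega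
  rw [kpTerm, e, hs, qPow_kpPoint hq, heckeTerm_eq_zpow hq0]
  ring

/-- For `r + s < 0` the number `2(r + s) + 1` is negative, so `sg(x) = -(-1)^(r+s)`: this is the
minus sign before the second quadrant in the double sum. -/
lemma kpTerm_inr (hq : q = Complex.exp (2 * Real.pi * Complex.I * (τ : ℂ))) (p : negPairs) :
    kpTerm 10 τ (kpEquiv (Sum.inr p)) =
      -(qPow τ (29 / 40) * heckeTerm 6 6 1 (q ^ 6) (q ^ 4) q p) := by
  obtain ⟨⟨r, s⟩, h1, h2⟩ := p
  simp only at h1 h2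
  have hq0 : q ≠ 0 := hq ▸ Complex.exp_ne_zero _
  have e : (kpEquiv (Sum.inr ⟨(r, s), h1, h2⟩) : ℝ × ℝ) = kpPoint (r, s) := rfl
  have hs : (if 0 ≤ (kpPoint (r, s)).1 then 1 else -1 : ℂ) = -(-1 : ℂ) ^ (r + s) := by
    have h : 0 ≤ (kpPoint (r, s)).1 ↔ 0 ≤ signedOdd (r + s) := by
      simp only [kpPoint]
      rw [← Int.cast_nonneg_iff (R := ℝ)]
      constructor <;> intro h <;> linarith
    rcases Int.even_or_odd (r + s) with h3 | h3
    · rw [h3.neg_one_zpow, if_neg (h.not.2 ?_)]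
      rw [signedOdd, if_pos (Int.even_iff.1 h3)]; omega
    · rw [h3.neg_one_zpow, if_pos (h.2 ?_), neg_neg]
      rw [signedOdd, if_neg (by rw [Int.odd_iff.1 h3]; norm_num)]; omega
  rw [kpTerm, e, hs, qPow_kpPoint hq, heckeTerm_eq_zpow hq0]
  ring

lemma hasSum_kpTerm (hq : q = Complex.exp (2 * Real.pi * Complex.I * (τ : ℂ))) (hq1 : ‖q‖ < 1) :
    HasSum (fun p : kpIndex 1 5 10 => kpTerm 10 τ p)
      (qPow τ (29 / 40) * heckeSum 6 6 1 (q ^ 6) (q ^ 4) q) := by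
  have hq0 : q ≠ 0 := hq ▸ Complex.exp_ne_zero _
  obtain ⟨h1, h2⟩ := heckeSummable hq0 hq1
  rw [← kpEquiv.hasSum_iff, heckeSum, mul_sub, sub_eq_add_neg]
  refine HasSum.sum ?_ ?_
  · exact (h1.hasSum.mul_left _).congr_fun fun p => kpTerm_inl hq p
  · exact (h2.hasSum.mul_left _).neg.congr_fun fun p => kpTerm_inr hq p

end StringFunction

end HeckeString

theorem mainTheorem10 (τ : UpperHalfPlane) (q : ℂ)
    (hq : q = Complex.exp (2 * Real.pi * Complex.I * (τ : ℂ))) :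
    -- the Hecke-type double-sum evaluation
    (HeckeString.HeckeSummable 6 6 1 (q ^ 6) (q ^ 4) q ∧
      HeckeString.heckeSum 6 6 1 (q ^ 6) (q ^ 4) q =
        HeckeString.thetaJ 4 10 q * HeckeString.thetaJ 3 15 q) ∧
    -- the string function of level 10 with `m = 1`, `ℓ = 5` in terms of the double-sum
    ((Summable fun p : HeckeString.kpIndex 1 5 10 => HeckeString.kpTerm 10 τ p) ∧
      HeckeString.stringFunction 1 5 10 τ =
        ModularForm.eta (τ : ℂ) ^ (-3 : ℤ) * HeckeString.qPow τ (29 / 40) *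
          HeckeString.heckeSum 6 6 1 (q ^ 6) (q ^ 4) q) ∧
    -- the product evaluation of that string function
    HeckeString.stringFunction 1 5 10 τ =
      ModularForm.eta (τ : ℂ) ^ (-3 : ℤ) * HeckeString.qPow τ (29 / 40) *
        (∏' n : {n : ℕ // 1 ≤ n ∧ n % 5 ≠ 1 ∧ n % 5 ≠ 4}, (1 - q ^ (2 * (n : ℕ)))) *
        ∏' n : {n : ℕ // 1 ≤ n ∧ n % 5 ≠ 2 ∧ n % 5 ≠ 3}, (1 - q ^ (3 * (n : ℕ))) := by
  have hq0 : q ≠ 0 := hq ▸ Complex.exp_ne_zero _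
  have hq1 : ‖q‖ < 1 := hq ▸ UpperHalfPlane.norm_exp_two_pi_I_lt_one τ
  have hsum := HeckeString.hasSum_kpTerm hq hq1
  have hstr : HeckeString.stringFunction 1 5 10 τ =
      ModularForm.eta (τ : ℂ) ^ (-3 : ℤ) * HeckeString.qPow τ (29 / 40) *
        HeckeString.heckeSum 6 6 1 (q ^ 6) (q ^ 4) q := by
    rw [HeckeString.stringFunction, hsum.tsum_eq, mul_assoc]
  refine ⟨⟨HeckeString.heckeSummable hq0 hq1, ?_⟩, ⟨hsum.summable, hstr⟩, ?_⟩
  · rw [HeckeString.heckeSum_eq hq0 hq1]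
    rfl
  · rw [hstr, HeckeString.heckeSum_eq hq0 hq1, HeckeString.theta_four_ten_eq_tprod hq0 hq1,
      HeckeString.theta_three_fifteen_eq_tprod hq0 hq1, mul_assoc _ (∏' _, _)]
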